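/- For $q\in[0,1)$ let $\mathcal M_N^q$ be the Mallows measure on the permutations $w$ of $\{1,\dots,N\}$, $\mathcal M_N^q(w)=q^{\mathrm{inv}(w)}/\sum_v q^{\mathrm{inv}(v)}$, where $\mathrm{inv}$ is the number of inversions, and let $H_{L,K}(w)=\#\{i: 1\le i\le L,\ 1\le w(i)\le K\}$. For $\beta>0$ and $x,y\in(0,1)$ put $$h_\beta(x,y)=\frac1\beta\Big[\ln(1-e^{-\beta})-\ln\big(e^{-\beta x}+e^{-\beta y}-e^{-\beta(x+y)}-e^{-\beta}\big)\Big],$$ $$\sigma_\beta(x,y)=\sqrt{\frac{\beta(1-e^{-\beta})}{(1-e^{-\beta(x-h_\beta(x,y))})(1-e^{-\beta(y-h_\beta(x,y))})}},\qquad z_\beta(y)=\frac{e^{-\beta}-e^{-\beta(1-y)}}{1-e^{-\beta(1-y)}}.$$ **Theorem.** Let $r\in\mathbb N$, $\beta>0$, $\alpha=(\alpha_1,\dots,\alpha_r)\in\mathbb R^r$, $x\in(0,1)$ and $0<y_1<\dots<y_r<1$. Let $C$ be the symmetric $r\times r$ matrix with $$C(i,i)=\frac1{\sigma_\beta(x,y_i)^2},\qquad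 C(i,j)=\sqrt{\frac{z_\beta(y_i)}{z_\beta(y_j)\,\sigma_\beta(x,y_i)^2\,\sigma_\beta(x,y_j)^2}}\quad(i<j).$$ Then $\det C>0$, and with $q=1-\beta/N$, $$\lim_{N\to\infty}\big(\sqrt{2\pi N}\big)^r\sqrt{\det C}\;\mathcal M_N^q\Big(H_{\lfloor xN\rfloor,\lfloor y_iN\rfloor}(w)=\big\lfloor h_\beta(x,y_i)N+\alpha_i\sqrt N\big\rfloor\ \text{ for all } 1\le i\le r\Big)=\exp\Big(-\frac{\alpha\, C^{-1}\alpha^{T}}2\Big).$$ -/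

import Mathlib

open Filter Topology

noncomputable section

namespace Mallows

/-- The number of inversions of a permutation `w` of `{0, …, N - 1}`:
pairs `i < j` with `w j < w i`. -/
def inv {N : ℕ} (w : Equiv.Perm (Fin N)) : ℕ :=
  (Finset.univ.filter fun p : Fin N × Fin N => p.1 < p.2 ∧ w p.2 < w p.1).card

/-- The partition function `∑_w q ^ inv(w)`, i.e. the inverse of the normalization constant. -/
def partition (N : ℕ) (q : ℝ) : ℝ :=
  ∑ w : Equiv.Perm (Fin N), q ^ inv w

/-- The probability of the event `E` under the Mallows measure with parameter `q` on the
permutations of size `N`: every `w` has probability `q ^ inv(w) / ∑_v q ^ inv(v)`. -/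
def prob (N : ℕ) (q : ℝ) (E : Set (Equiv.Perm (Fin N))) : ℝ :=
  ∑ w : Equiv.Perm (Fin N), E.indicator (fun v => q ^ inv v / partition N q) w

/-- The height function `H_{L,K}(w)`: the number of `i` among the first `L` positions such that
`w i` is among the `K` smallest values. Positions and values are numbered from `0` here, so that
`1 ≤ i ≤ L` and `1 ≤ w(i) ≤ K` become `i < L` and `w i < K`. -/
def height {N : ℕ} (L K : ℕ) (w : Equiv.Perm (Fin N)) : ℕ :=
  (Finset.univ.filter fun i : Fin N => (i : ℕ) < L ∧ (w i : ℕ) < K).card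

/-- The limit shape `h_β(x, y)`. -/
def h (β x y : ℝ) : ℝ :=
  1 / β * (Real.log (1 - Real.exp (-β)) -
    Real.log (Real.exp (-β * x) + Real.exp (-β * y) - Real.exp (-β * (x + y)) - Real.exp (-β)))

/-- The function `σ_β(x, y)`; the limiting variance at `(x, y)` is `1 / σ_β(x, y) ^ 2`. -/
def sigma (β x y : ℝ) : ℝ :=
  Real.sqrt (β * (1 - Real.exp (-β)) /
    ((1 - Real.exp (-β * (x - h β x y))) * (1 - Real.exp (-β * (y - h β x y)))))

/-- The function `z_β(y) = (e^{-β} - e^{-β(1-y)}) / (1 - e^{-β(1-y)})`, which is negative for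
`0 < y < 1`; only ratios of its values are used. -/
def z (β y : ℝ) : ℝ :=
  (Real.exp (-β) - Real.exp (-β * (1 - y))) / (1 - Real.exp (-β * (1 - y)))

/-- The symmetric covariance matrix `C`: the diagonal entries are `1 / σ_β(x, y_i)²`, and the
entries with `i < j` are `√(z_β(y_i) / (z_β(y_j) σ_β(x, y_i)² σ_β(x, y_j)²))`. -/
def cov {r : ℕ} (β x : ℝ) (y : Fin r → ℝ) : Matrix (Fin r) (Fin r) ℝ :=
  Matrix.of fun i j =>
    if i = j then 1 / sigma β x (y i) ^ 2
    else Real.sqrt (z β (y (min i j)) /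
      (z β (y (max i j)) * sigma β x (y i) ^ 2 * sigma β x (y j) ^ 2))

end Mallows

end

/-!
The set of values taken at the first `L` positions of a Mallows permutation is a random `L`-element
set `S` whose probability is proportional to `q` to the number of pairs `b < a` with `a ∈ S` and
`b ∉ S`: inserting the largest value into a smaller permutation gives the recursion `mass_succ`,
which is the `q`-Pascal recursion of `setMass`. Hence `K ↦ H_{L, K}`, read downwards from `K = N`, is
a Markov chain with `q`-hypergeometric transition probabilities, and the probability in the theorem
is a product of `r` of them (`prob_heightEvent`).

Let `q = e ^ (-t)`. Stirling's formula and the trapezoidal rule give the logarithm of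
`(1 - q) ⋯ (1 - q ^ n)` up to `o (1)` when `t → 0` and `t n` converges (`tendsto_logPoch_sub`), and so
every transition probability is `e ^ (rate / t)` up to an explicit factor of order `√t`. The function
`rate` is concave in the unknown height. Its maximizer `mode` is explicit, because stationarity is
an equation of degree one in `e ^ (-u)`; the maximal value is `0` (`rate_mode`), and the second
derivative there is a simple product (`curvature_mode`). A second-order expansion gives a Gaussian
local limit theorem for one transition (`tendsto_transition`).

The limit shape satisfies `β h_β(x, y) = mode (β y) (β x) β`, and `mode` is consistent under further
conditioning (`mode_mode`). Linearizing `mode` around the limit shape turns the deviations `α i` into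
the innovations `α i - a i / a (i + 1) * α (i + 1)` of a Gaussian Markov chain
(`tendsto_sqrt_mul_transition`). The matrix `C` is the covariance matrix `a i * a j * c (max i j)` of
that chain (`cov_eq_markovCov`), so its determinant is the product of the innovation variances and
its inverse quadratic form is the sum of the normalized squares of the innovations
(`det_markovCov`, `dotProduct_inv_markovCov`).
-/

namespace Mallows

/-! ### Inserting the largest value into a permutation -/

/-- The permutation of `Fin (N + 1)` that has the largest value at position `p` and whose remaining
values form the pattern `σ`. -/
def insertMax {N : ℕ} (p : Fin (N + 1)) (σ : Equiv.Perm (Fin N)) : Equiv.Perm (Fin (N + 1)) :=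
  (finSuccEquiv' p).trans ((Equiv.optionCongr σ).trans (finSuccEquiv' (Fin.last N)).symm)

@[simp] theorem insertMax_self {N : ℕ} (p : Fin (N + 1)) (σ : Equiv.Perm (Fin N)) :
    insertMax p σ p = Fin.last N := by
  simp [insertMax]

@[simp] theorem insertMax_succAbove {N : ℕ} (p : Fin (N + 1)) (σ : Equiv.Perm (Fin N))
    (i : Fin N) : insertMax p σ (p.succAbove i) = (σ i).castSucc := by
  simp [insertMax]

theorem insertMax_bijective (N : ℕ) :
    Function.Bijective
      (fun a : Fin (N + 1) × Equiv.Perm (Fin N) => insertMax a.1 a.2) := by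
  refine (Fintype.bijective_iff_injective_and_card _).2 ⟨?_, ?_⟩
  · rintro ⟨p, σ⟩ ⟨p', σ'⟩ h
    dsimp only at h
    have hp : p = p' := by
      apply (insertMax p' σ').injective
      rw [← h, insertMax_self, h, insertMax_self]
    subst hp
    have hσ : σ = σ' := by
      ext i
      have := DFunLike.congr_fun h (p.succAbove i)
      rw [insertMax_succAbove, insertMax_succAbove] at this
      rw [Fin.castSucc_injective _ this]
    rw [hσ]
  · simp [Fintype.card_perm, Nat.factorial_succ]

theorem sum_perm_succ {N : ℕ} (F : Equiv.Perm (Fin (N + 1)) → ℝ) :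
    ∑ w, F w = ∑ p : Fin (N + 1), ∑ σ : Equiv.Perm (Fin N), F (insertMax p σ) := by
  rw [← Fintype.sum_prod_type']
  exact ((insertMax_bijective N).sum_comp F).symm

theorem inv_eq_sum {N : ℕ} (w : Equiv.Perm (Fin N)) :
    inv w = ∑ i, ∑ j, if i < j ∧ w j < w i then 1 else 0 := by
  rw [inv, Finset.card_filter, Fintype.sum_prod_type]

theorem inv_insertMax {N : ℕ} (p : Fin (N + 1)) (σ : Equiv.Perm (Fin N)) :
    inv (insertMax p σ) = (N - p) + inv σ := by
  rw [inv_eq_sum, inv_eq_sum, Fin.sum_univ_succAbove _ p]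
  congr 1
  · rw [← Finset.card_filter]
    have : (Finset.univ.filter fun j : Fin (N + 1) => p < j ∧ insertMax p σ j < insertMax p σ p) =
        Finset.Ioi p := by
      ext j
      simp only [Finset.mem_filter, Finset.mem_univ, true_and, Finset.mem_Ioi, insertMax_self,
        and_iff_left_iff_imp]
      intro hj
      rw [Fin.lt_last_iff_ne_last, ← insertMax_self p σ]
      exact fun h => hj.ne' ((insertMax p σ).injective h)
    rw [this, Fin.card_Ioi]
    omega
  · refine Finset.sum_congr rfl fun i _ => ?_
    rw [Fin.sum_univ_succAbove _ p]
    simp only [insertMax_self, insertMax_succAbove, Fin.castSucc_lt_castSucc_iff,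
      Fin.succAbove_lt_succAbove_iff]
    simp [Fin.le_last]

theorem height_eq_sum {N : ℕ} (L K : ℕ) (w : Equiv.Perm (Fin N)) :
    height L K w = ∑ i : Fin N, if (i : ℕ) < L ∧ (w i : ℕ) < K then 1 else 0 := by
  rw [height, Finset.card_filter]

theorem height_insertMax {N : ℕ} (L K : ℕ) (hK : K ≤ N) (p : Fin (N + 1))
    (σ : Equiv.Perm (Fin N)) :
    height L K (insertMax p σ) = height (if (p : ℕ) < L then L - 1 else L) K σ := by
  rw [height_eq_sum, height_eq_sum, Fin.sum_univ_succAbove _ p]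
  rw [if_neg (by simp; omega), zero_add]
  refine Finset.sum_congr rfl fun i _ => ?_
  have : ((p.succAbove i : Fin (N + 1)) : ℕ) < L ↔ (i : ℕ) < if (p : ℕ) < L then L - 1 else L := by
    rw [Fin.succAbove]
    split_ifs with h1 h2 h2 <;> simp only [Fin.lt_def, Fin.val_castSucc, Fin.val_succ] at * <;> omega
  simp only [insertMax_succAbove, this, Fin.val_castSucc]

theorem height_top {N L : ℕ} (hL : L ≤ N) (w : Equiv.Perm (Fin N)) : height L N w = L := by
  simp only [height, Fin.is_lt, and_true]
  rw [Fin.card_filter_val_lt]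
  omega

/-! ### Gaussian binomial coefficients -/

/-- The `q`-integer `1 + q + ⋯ + q ^ (n - 1)`. -/
noncomputable def qInt (q : ℝ) (n : ℕ) : ℝ := ∑ i ∈ Finset.range n, q ^ i

/-- The `q`-factorial `[1] [2] ⋯ [n]`. -/
noncomputable def qFact (q : ℝ) (n : ℕ) : ℝ := ∏ k ∈ Finset.range n, qInt q (k + 1)

/-- The Gaussian binomial coefficient, defined by the `q`-Pascal recursion. -/
noncomputable def qBinom (q : ℝ) : ℕ → ℕ → ℝ
  | _, 0 => 1
  | 0, _ + 1 => 0
  | n + 1, k + 1 => q ^ (n - k) * qBinom q n k + qBinom q n (k + 1)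

@[simp] theorem qBinom_zero_right (q : ℝ) (n : ℕ) : qBinom q n 0 = 1 := by
  cases n <;> simp [qBinom]

theorem qBinom_succ_succ (q : ℝ) (n k : ℕ) :
    qBinom q (n + 1) (k + 1) = q ^ (n - k) * qBinom q n k + qBinom q n (k + 1) := by
  simp [qBinom]

theorem qBinom_eq_zero (q : ℝ) : ∀ {n k : ℕ}, n < k → qBinom q n k = 0
  | _, 0, h => by omega
  | 0, _ + 1, _ => by simp [qBinom]
  | n + 1, k + 1, h => by
    rw [qBinom_succ_succ, qBinom_eq_zero q (by omega), qBinom_eq_zero q (by omega)]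
    simp

theorem qInt_add (q : ℝ) (m n : ℕ) : qInt q (m + n) = qInt q m + q ^ m * qInt q n := by
  simp only [qInt, Finset.sum_range_add, Finset.mul_sum, pow_add]

theorem qInt_pos {q : ℝ} (hq : 0 < q) {n : ℕ} (hn : 0 < n) : 0 < qInt q n :=
  Finset.sum_pos (fun _ _ => by positivity) (by simpa using hn.ne')

theorem qFact_pos {q : ℝ} (hq : 0 < q) (n : ℕ) : 0 < qFact q n :=
  Finset.prod_pos fun _ _ => qInt_pos hq (Nat.succ_pos _)

theorem qFact_succ (q : ℝ) (n : ℕ) : qFact q (n + 1) = qFact q n * qInt q (n + 1) := by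
  rw [qFact, Finset.prod_range_succ, ← qFact]

theorem qBinom_mul_qFact (q : ℝ) : ∀ d k : ℕ,
    qBinom q (k + d) k * (qFact q k * qFact q d) = qFact q (k + d)
  | d, 0 => by simp [qFact]
  | 0, k + 1 => by
    have h := qBinom_mul_qFact q 0 k
    rw [add_zero] at h ⊢
    rw [qBinom_succ_succ, qBinom_eq_zero q (Nat.lt_succ_self k), qFact_succ]
    simp only [Nat.sub_self, pow_zero, one_mul, add_zero]
    linear_combination qInt q (k + 1) * h
  | d + 1, k + 1 => by
    have h1 := qBinom_mul_qFact q (d + 1) k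
    have h2 := qBinom_mul_qFact q d (k + 1)
    have e1 : k + 1 + (d + 1) = (k + (d + 1)) + 1 := by ring
    have e2 : k + 1 + d = k + (d + 1) := by ring
    rw [e2] at h2
    rw [e1, qBinom_succ_succ, qFact_succ q (k + (d + 1)),
      show k + (d + 1) + 1 = (d + 1) + (k + 1) by ring, qInt_add,
      show k + (d + 1) - k = d + 1 by omega]
    rw [qFact_succ q k, qFact_succ q d] at *
    linear_combination q ^ (d + 1) * qInt q (k + 1) * h1 + qInt q (d + 1) * h2

theorem qBinom_eq_div {q : ℝ} (hq : 0 < q) (k d : ℕ) :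
    qBinom q (k + d) k = qFact q (k + d) / (qFact q k * qFact q d) := by
  have := qFact_pos hq k
  have := qFact_pos hq d
  rw [eq_div_iff (by positivity), qBinom_mul_qFact]

/-! ### The law of the height function along a vertical line -/

/-- The event that `H_{L, K i} = m i` for all `i < j`. -/
def heightEvent (K m : ℕ → ℕ) (j : ℕ) (N L : ℕ) : Set (Equiv.Perm (Fin N)) :=
  {w | ∀ i < j, height L (K i) w = m i}

/-- The total weight `∑ q ^ inv(w)` of the permutations with `H_{L, K i} = m i` for `i < j`. -/
noncomputable def mass (q : ℝ) (K m : ℕ → ℕ) (j N L : ℕ) : ℝ :=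
  ∑ w : Equiv.Perm (Fin N), (heightEvent K m j N L).indicator (fun v => q ^ inv v) w

theorem sum_pow_lt (q : ℝ) {N L : ℕ} (hL : L ≤ N) :
    ∑ p : Fin (N + 1), (if (p : ℕ) < L then q ^ (N - p) else 0) =
      q ^ (N + 1 - L) * qInt q L := by
  rw [Fin.sum_univ_eq_sum_range (fun p => if p < L then q ^ (N - p) else 0) (N + 1),
    ← Finset.sum_filter]
  have : (Finset.range (N + 1)).filter (fun p => p < L) = Finset.range L := by
    ext; simp; omega
  rw [this, ← Finset.sum_range_reflect, qInt, Finset.mul_sum]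
  refine Finset.sum_congr rfl fun i hi => ?_
  rw [← pow_add]
  congr 1
  have := Finset.mem_range.1 hi
  omega

theorem sum_pow_not_lt (q : ℝ) {N L : ℕ} (hL : L ≤ N) :
    ∑ p : Fin (N + 1), (if (p : ℕ) < L then 0 else q ^ (N - p)) = qInt q (N + 1 - L) := by
  have h := sum_pow_lt q hL
  have h2 : ∑ p : Fin (N + 1), q ^ (N - (p : ℕ)) = qInt q (N + 1) := by
    rw [Fin.sum_univ_eq_sum_range (fun p => q ^ (N - p)) (N + 1), qInt]
    exact Finset.sum_range_reflect (fun i => q ^ i) (N + 1)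
  have h3 : ∑ p : Fin (N + 1), (if (p : ℕ) < L then q ^ (N - p) else 0) +
      ∑ p : Fin (N + 1), (if (p : ℕ) < L then 0 else q ^ (N - p)) =
      ∑ p : Fin (N + 1), q ^ (N - (p : ℕ)) := by
    rw [← Finset.sum_add_distrib]
    exact Finset.sum_congr rfl fun i _ => by split_ifs <;> simp
  have h4 := qInt_add q (N + 1 - L) L
  rw [show N + 1 - L + L = N + 1 by omega] at h4
  linarith

theorem heightEvent_insertMax {K m : ℕ → ℕ} {j N L : ℕ} (hK : ∀ i < j, K i ≤ N)
    (p : Fin (N + 1)) (σ : Equiv.Perm (Fin N)) :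
    insertMax p σ ∈ heightEvent K m j (N + 1) L ↔
      σ ∈ heightEvent K m j N (if (p : ℕ) < L then L - 1 else L) := by
  simp only [heightEvent, Set.mem_ofPred_eq]
  refine forall₂_congr fun i hi => ?_
  rw [height_insertMax L (K i) (hK i hi)]

/-- Conditioning on the position of the largest value. -/
theorem mass_succ (q : ℝ) {K m : ℕ → ℕ} {j N L : ℕ} (hK : ∀ i < j, K i ≤ N) :
    mass q K m j (N + 1) L =
      ∑ p : Fin (N + 1), q ^ (N - (p : ℕ)) *
        mass q K m j N (if (p : ℕ) < L then L - 1 else L) := by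
  rw [mass, sum_perm_succ]
  refine Finset.sum_congr rfl fun p _ => ?_
  rw [mass, Finset.mul_sum]
  refine Finset.sum_congr rfl fun σ _ => ?_
  classical
  rw [Set.indicator_apply, Set.indicator_apply, heightEvent_insertMax hK, inv_insertMax, pow_add]
  split_ifs <;> simp

theorem mass_succ_eq (q : ℝ) {K m : ℕ → ℕ} {j N L : ℕ} (hK : ∀ i < j, K i ≤ N) (hL : L ≤ N) :
    mass q K m j (N + 1) L = q ^ (N + 1 - L) * qInt q L * mass q K m j N (L - 1) +
      qInt q (N + 1 - L) * mass q K m j N L := by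
  rw [mass_succ q hK, ← sum_pow_lt q hL, ← sum_pow_not_lt q hL, Finset.sum_mul, Finset.sum_mul,
    ← Finset.sum_add_distrib]
  exact Finset.sum_congr rfl fun p _ => by split_ifs <;> simp

theorem mass_succ_self (q : ℝ) {K m : ℕ → ℕ} {j N : ℕ} (hK : ∀ i < j, K i ≤ N) :
    mass q K m j (N + 1) (N + 1) = qInt q (N + 1) * mass q K m j N N := by
  rw [mass_succ q hK, qInt, ← Finset.sum_range_reflect, Finset.sum_mul,
    ← Fin.sum_univ_eq_sum_range (fun p => q ^ (N + 1 - 1 - p) * mass q K m j N N)]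
  refine Finset.sum_congr rfl fun p _ => ?_
  rw [if_pos p.is_lt]
  rfl

/-- The weight `mass` normalized so that it satisfies the recursion of Gaussian binomial
coefficients; it is the sum, over the `L`-element sets `S` of values in the event, of `q` to the
number of pairs `b < a` with `a ∈ S` and `b ∉ S`. -/
noncomputable def setMass (q : ℝ) (K m : ℕ → ℕ) (j N L : ℕ) : ℝ :=
  if L ≤ N then mass q K m j N L / (qFact q L * qFact q (N - L)) else 0

theorem setMass_succ_zero {q : ℝ} (hq : 0 < q) {K m : ℕ → ℕ} {j N : ℕ} (hK : ∀ i < j, K i ≤ N) :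
    setMass q K m j (N + 1) 0 = setMass q K m j N 0 := by
  have h1 := qFact_pos hq N
  have h2 := qInt_pos hq (Nat.succ_pos N)
  rw [setMass, setMass, if_pos (Nat.zero_le _), if_pos (Nat.zero_le _),
    mass_succ_eq q hK (Nat.zero_le _)]
  simp only [Nat.sub_zero, qFact_succ]
  have h3 : qFact q 0 = 1 := by simp [qFact]
  have h4 : qInt q 0 = 0 := by simp [qInt]
  rw [h3, h4]
  field_simp
  ring

theorem setMass_succ_succ {q : ℝ} (hq : 0 < q) {K m : ℕ → ℕ} {j N L : ℕ}
    (hK : ∀ i < j, K i ≤ N) :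
    setMass q K m j (N + 1) (L + 1) =
      q ^ (N - L) * setMass q K m j N L + setMass q K m j N (L + 1) := by
  have hF := qFact_pos hq
  have hI : ∀ n, 0 < qInt q (n + 1) := fun n => qInt_pos hq (Nat.succ_pos n)
  rcases lt_trichotomy L N with h | rfl | h
  · obtain ⟨d, rfl⟩ : ∃ d, N = L + 1 + d := ⟨N - (L + 1), by omega⟩
    rw [setMass, setMass, setMass, if_pos (by omega), if_pos (by omega), if_pos (by omega),
      mass_succ_eq q hK (by omega), show L + 1 + d + 1 - (L + 1) = d + 1 by omega,
      show L + 1 + d - L = d + 1 by omega, show L + 1 + d - (L + 1) = d by omega,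
      qFact_succ, qFact_succ, Nat.add_sub_cancel]
    have := hF L; have := hF d; have := hI L; have := hI d
    field_simp
  · rw [setMass, setMass, setMass, if_pos le_rfl, if_pos le_rfl, if_neg (by omega),
      mass_succ_self q hK, qFact_succ]
    have := hF L; have := hI L
    simp only [Nat.sub_self, pow_zero, qFact, Finset.range_zero, Finset.prod_empty] at *
    field_simp
    simp
  · rw [setMass, setMass, setMass, if_neg (by omega), if_neg (by omega), if_neg (by omega)]
    simp

theorem setMass_base (q : ℝ) (K m : ℕ → ℕ) (j L : ℕ) :
    setMass q K m (j + 1) (K j) L = if L = m j then setMass q K m j (K j) (m j) else 0 := by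
  by_cases hL : L ≤ K j
  · have : mass q K m (j + 1) (K j) L = if L = m j then mass q K m j (K j) (m j) else 0 := by
      split_ifs with h
      · subst h
        rw [mass, mass]
        have : heightEvent K m (j + 1) (K j) (m j) = heightEvent K m j (K j) (m j) := by
          ext w
          simp only [heightEvent, Set.mem_ofPred_eq, Nat.lt_succ_iff_lt_or_eq, or_imp, forall_and,
            forall_eq, height_top hL, and_true]
        rw [this]
      · refine Finset.sum_eq_zero fun w _ => Set.indicator_of_notMem (fun hw => h ?_) _
        have := hw j (Nat.lt_succ_self j)
        rwa [height_top hL] at this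
    rw [setMass, if_pos hL, this]
    split_ifs with h
    · subst h
      rw [setMass, if_pos hL]
    · simp
  · rw [setMass, if_neg hL]
    split_ifs with h
    · subst h
      rw [setMass, if_neg hL]
    · rfl

/-- The values between `K j` and `K j + n` fill a block whose intersection with the first `L`
positions contributes a Gaussian binomial coefficient. -/
theorem setMass_add {q : ℝ} (hq : 0 < q) {K m : ℕ → ℕ} {j : ℕ} (hK : ∀ i < j, K i ≤ K j)
    (hm : m j ≤ K j) (n L : ℕ) :
    setMass q K m (j + 1) (K j + n) L =
      setMass q K m j (K j) (m j) *
        if m j ≤ L then q ^ ((L - m j) * (K j - m j)) * qBinom q n (L - m j) else 0 := by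
  have hK' : ∀ n, ∀ i < j + 1, K i ≤ K j + n := fun n i hi => by
    rcases Nat.lt_succ_iff_lt_or_eq.1 hi with h | rfl
    · exact (hK i h).trans (Nat.le_add_right _ _)
    · exact Nat.le_add_right _ _
  induction n generalizing L with
  | zero =>
    rw [add_zero, setMass_base]
    rcases lt_trichotomy L (m j) with h | rfl | h
    · rw [if_neg h.ne, if_neg (by omega), mul_zero]
    · simp
    · rw [if_neg h.ne', if_pos h.le, qBinom_eq_zero q (by omega)]
      simp
  | succ n ih =>
    rw [← add_assoc]
    cases L with
    | zero =>
      rw [setMass_succ_zero hq (hK' n), ih]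
      congr 1
      simp
    | succ L =>
      rw [setMass_succ_succ hq (hK' n), ih, ih]
      rcases lt_trichotomy (L + 1) (m j) with h | h | h
      · rw [if_neg (by omega), if_neg (by omega), if_neg (by omega)]; simp
      · rw [if_neg (by omega), if_pos (by omega), if_pos (by omega), ← h]; simp
      · obtain ⟨k, rfl⟩ : ∃ k, L = m j + k := ⟨L - m j, by omega⟩
        obtain ⟨d, hd⟩ : ∃ d, K j = m j + d := ⟨K j - m j, by omega⟩
        rw [if_pos (by omega), if_pos (by omega), if_pos (by omega),
          show m j + k + 1 - m j = k + 1 by omega, show m j + k - m j = k by omega,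
          qBinom_succ_succ, show K j - m j = d by omega,
          show K j + n - (m j + k) = d + n - k by omega]
        rcases le_or_gt k n with hkn | hkn
        · rw [show d + n - k = d + (n - k) by omega]
          ring
        · rw [qBinom_eq_zero q hkn]
          ring

theorem mass_zero_eq_partition (q : ℝ) (K m : ℕ → ℕ) (N L : ℕ) :
    mass q K m 0 N L = partition N q := by
  rw [mass, partition]
  refine Finset.sum_congr rfl fun w _ => Set.indicator_of_mem ?_ _
  simp [heightEvent]

theorem partition_eq_qFact (q : ℝ) (N : ℕ) : partition N q = qFact q N := by
  induction N with
  | zero => simp [partition, qFact, inv]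
  | succ N ih =>
    rw [← mass_zero_eq_partition q id id (N + 1) (N + 1), mass_succ_self q (by simp),
      mass_zero_eq_partition, ih, qFact_succ, mul_comm]

/-- The `q`-hypergeometric probability that, given `H_{L, n} = l`, one has `H_{L, k} = m`, where
`a = m`, `b = k - m`, `c = l - m` and `a + b + c + d = n`. -/
noncomputable def transition (q : ℝ) (a b c d : ℕ) : ℝ :=
  q ^ (b * c) * (qFact q (a + b) * qFact q (a + c) * qFact q (b + d) * qFact q (c + d)) /
    (qFact q (a + b + c + d) * (qFact q a * qFact q b * qFact q c * qFact q d))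

theorem setMass_eq_prod {q : ℝ} (hq : 0 < q) {K m : ℕ → ℕ} (hK : Monotone K) (hm : Monotone m)
    (hmK : Monotone fun i => K i - m i) (hle : ∀ i, m i ≤ K i) (j : ℕ) :
    setMass q K m j (K j) (m j) = qBinom q (K j) (m j) *
      ∏ i ∈ Finset.range j, transition q (m i) (K i - m i) (m (i + 1) - m i)
        (K (i + 1) - m (i + 1) - (K i - m i)) := by
  have hF := qFact_pos hq
  induction j with
  | zero =>
    rw [setMass, if_pos (hle 0), mass_zero_eq_partition, partition_eq_qFact]
    obtain ⟨d, hd⟩ : ∃ d, K 0 = m 0 + d := ⟨K 0 - m 0, by have := hle 0; omega⟩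
    rw [hd, qBinom_eq_div hq]
    simp
  | succ j ih =>
    rw [Finset.prod_range_succ]
    have h1 := hle j
    have h2 := hle (j + 1)
    have h3 := hm (Nat.le_succ j)
    have h4 := hK (Nat.le_succ j)
    have h5 := hmK (Nat.le_succ j)
    simp only [Nat.succ_eq_add_one] at h3 h4 h5
    set P := ∏ i ∈ Finset.range j, transition q (m i) (K i - m i) (m (i + 1) - m i)
        (K (i + 1) - m (i + 1) - (K i - m i))
    have key := setMass_add hq (fun i hi => hK hi.le) h1 (K (j + 1) - K j) (m (j + 1))
    rw [show K j + (K (j + 1) - K j) = K (j + 1) by omega, ih, if_pos h3] at key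
    rw [key]
    generalize hb : K j - m j = b at *
    generalize hc : m (j + 1) - m j = c at *
    generalize hd : K (j + 1) - m (j + 1) - b = d at *
    generalize m j = a at *
    rw [show K (j + 1) - K j = c + d by omega, show K j = a + b by omega,
      show K (j + 1) = (a + c) + (b + d) by omega, show m (j + 1) = a + c by omega,
      qBinom_eq_div hq, qBinom_eq_div hq, qBinom_eq_div hq, transition,
      show a + c + (b + d) = a + b + c + d by ring, mul_comm b c]
    have := hF a; have := hF b; have := hF c; have := hF d
    have := hF (a + b + c + d); have := hF (a + b); have := hF (c + d)
    have := hF (a + c); have := hF (b + d)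
    field_simp

/-- The Markov property of the height function along a vertical line: the joint law of its
values at heights `K 0 ≤ ⋯ ≤ K r = N` is a product of `q`-hypergeometric transition
probabilities. -/
theorem prob_heightEvent {q : ℝ} (hq : 0 < q) {K m : ℕ → ℕ} (hK : Monotone K) (hm : Monotone m)
    (hmK : Monotone fun i => K i - m i) (hle : ∀ i, m i ≤ K i) {r N L : ℕ} (hN : K r = N)
    (hL : m r = L) :
    prob N q (heightEvent K m r N L) =
      ∏ i ∈ Finset.range r, transition q (m i) (K i - m i) (m (i + 1) - m i)
        (K (i + 1) - m (i + 1) - (K i - m i)) := by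
  subst hN hL
  have hF := qFact_pos hq
  have h1 : prob (K r) q (heightEvent K m r (K r) (m r)) =
      mass q K m r (K r) (m r) / partition (K r) q := by
    rw [prob, mass, Finset.sum_div]
    refine Finset.sum_congr rfl fun w _ => ?_
    classical
    rw [Set.indicator_apply, Set.indicator_apply]
    split_ifs <;> simp
  have h2 := setMass_eq_prod hq hK hm hmK hle r
  rw [setMass, if_pos (hle r)] at h2
  rw [h1, partition_eq_qFact]
  obtain ⟨d, hd⟩ : ∃ d, K r = m r + d := ⟨K r - m r, by have := hle r; omega⟩
  rw [show K r - m r = d by omega] at h2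
  have h3 : qBinom q (K r) (m r) = qFact q (K r) / (qFact q (m r) * qFact q d) := by
    rw [hd, qBinom_eq_div hq]
  rw [h3] at h2
  have := hF (K r); have := hF (m r); have := hF d
  field_simp at h2 ⊢
  exact h2

/-! ### Asymptotics of `q`-factorials -/

/-- The function `(1 - e ^ (-u)) / u`, extended by `1` to `u = 0`. -/
noncomputable def expQuot (u : ℝ) : ℝ := dslope (fun u => 1 - Real.exp (-u)) 0 u

theorem hasDerivAt_one_sub_exp_neg (u : ℝ) :
    HasDerivAt (fun u => 1 - Real.exp (-u)) (Real.exp (-u)) u := by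
  simpa using ((hasDerivAt_neg u).exp).const_sub 1

theorem expQuot_zero : expQuot 0 = 1 := by
  rw [expQuot, dslope_same, (hasDerivAt_one_sub_exp_neg 0).deriv]
  simp

theorem expQuot_of_ne {u : ℝ} (hu : u ≠ 0) : expQuot u = (1 - Real.exp (-u)) / u := by
  rw [expQuot, dslope_of_ne _ hu, slope_def_field]
  simp

theorem one_sub_exp_neg_pos {u : ℝ} (hu : 0 < u) : 0 < 1 - Real.exp (-u) := by
  simpa using hu

theorem expQuot_pos (u : ℝ) : 0 < expQuot u := by
  rcases lt_trichotomy u 0 with h | rfl | h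
  · rw [expQuot_of_ne h.ne]
    exact div_pos_of_neg_of_neg (by simpa using h) h
  · rw [expQuot_zero]; exact one_pos
  · rw [expQuot_of_ne h.ne']
    exact div_pos (one_sub_exp_neg_pos h) h

theorem contDiff_expQuot : ContDiff ℝ 2 expQuot := by
  rw [contDiff_iff_contDiffAt]
  intro u
  have han : ∀ v : ℝ, AnalyticAt ℝ (fun u => 1 - Real.exp (-u)) v := fun v => by fun_prop
  rcases eq_or_ne u 0 with rfl | h
  · obtain ⟨p, hp⟩ := han 0
    have : AnalyticAt ℝ expQuot 0 := ⟨_, hp.has_fpower_series_dslope_fslope⟩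
    exact this.contDiffAt
  · have : ContDiffAt ℝ 2 (fun u => (1 - Real.exp (-u)) / u) u :=
      (han u).contDiffAt.div contDiffAt_id h
    refine this.congr_of_eventuallyEq ?_
    filter_upwards [isOpen_ne.mem_nhds h] with v hv using expQuot_of_ne hv

/-- The regular part `log ((1 - e ^ (-u)) / u)` of `log (1 - e ^ (-u))`. -/
noncomputable def logQuot (u : ℝ) : ℝ := Real.log (expQuot u)

theorem contDiff_logQuot : ContDiff ℝ 2 logQuot :=
  contDiff_expQuot.log fun u => (expQuot_pos u).ne'

theorem continuous_logQuot : Continuous logQuot := contDiff_logQuot.continuous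

theorem logQuot_zero : logQuot 0 = 0 := by rw [logQuot, expQuot_zero, Real.log_one]

theorem log_add_logQuot {u : ℝ} (hu : 0 < u) :
    Real.log u + logQuot u = Real.log (1 - Real.exp (-u)) := by
  rw [logQuot, expQuot_of_ne hu.ne', Real.log_div (one_sub_exp_neg_pos hu).ne' hu.ne']
  ring

/-- The integral of `log (1 - e ^ (-s))` over `0 ≤ s ≤ u`, with the logarithmic singularity at `0`
integrated explicitly. -/
noncomputable def logInt (u : ℝ) : ℝ := u * Real.log u - u + ∫ s in (0 : ℝ)..u, logQuot s

theorem logInt_zero : logInt 0 = 0 := by simp [logInt]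

theorem hasDerivAt_integral_logQuot (u : ℝ) :
    HasDerivAt (fun u => ∫ s in (0 : ℝ)..u, logQuot s) (logQuot u) u :=
  intervalIntegral.integral_hasDerivAt_right (continuous_logQuot.intervalIntegrable _ _)
    (continuous_logQuot.stronglyMeasurableAtFilter _ _) continuous_logQuot.continuousAt

theorem continuous_logInt : Continuous logInt := by
  refine (Real.continuous_mul_log.sub continuous_id).add ?_
  exact continuous_iff_continuousAt.2 fun u => (hasDerivAt_integral_logQuot u).continuousAt

theorem hasDerivAt_logInt {u : ℝ} (hu : 0 < u) :
    HasDerivAt logInt (Real.log (1 - Real.exp (-u))) u := by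
  have h := ((Real.hasDerivAt_mul_log hu.ne').sub (hasDerivAt_id u)).add
    (hasDerivAt_integral_logQuot u)
  rw [← log_add_logQuot hu]
  convert! h using 1
  ring

/-- The trapezoidal rule for a `C²` function on a fixed bounded range, with an error that is
quadratic in the mesh. -/
theorem exists_trapezoidal_error_le {f : ℝ → ℝ} (hf : ContDiff ℝ 2 f) (b : ℝ) :
    ∃ M, ∀ u ∈ Set.Ioc 0 b, ∀ n : ℕ, 0 < n →
      |trapezoidal_error f n 0 u| ≤ u ^ 3 * M / (12 * n ^ 2) := by
  have hc : Continuous (iteratedDeriv 2 f) := hf.continuous_iteratedDeriv 2 le_rfl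
  obtain ⟨M, hM⟩ := (isCompact_Icc (a := (0 : ℝ)) (b := b)).exists_bound_of_continuousOn
    hc.continuousOn
  refine ⟨max M 0, fun u hu n hn => ?_⟩
  have hu0 : (0 : ℝ) < u := hu.1
  have := trapezoidal_error_le_of_c2 (f := f) (a := 0) (b := u) hf.contDiffOn (ζ := max M 0)
    (fun x => ?_) hn
  · rwa [sub_zero, abs_of_pos hu0] at this
  · rw [Set.uIcc_of_lt hu0]
    by_cases hx : x ∈ Set.Icc 0 u
    · rw [iteratedDerivWithin_eq_iteratedDeriv (uniqueDiffOn_Icc hu0) hf.contDiffAt hx]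
      exact (hM x ⟨hx.1, hx.2.trans hu.2⟩).trans (le_max_left _ _)
    · -- outside the closed interval, derivatives within it are `0` by convention
      rw [iteratedDerivWithin_succ, derivWithin_zero_of_notMem_closure
        (by rwa [closure_Icc])]
      simp

/-- The logarithm of `(1 - e ^ (-t)) (1 - e ^ (-2t)) ⋯ (1 - e ^ (-nt))`. -/
noncomputable def logPoch (t : ℝ) (n : ℕ) : ℝ :=
  ∑ k ∈ Finset.range n, Real.log (1 - Real.exp (-(t * (k + 1))))

/-- Each factor splits as `log (t k)`, summed by the factorial, plus the regular part. -/
theorem logPoch_eq {t : ℝ} (ht : 0 < t) (n : ℕ) :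
    logPoch t n = n * Real.log t + Real.log n.factorial +
      ∑ k ∈ Finset.range n, logQuot (t * (k + 1)) := by
  have h : ∀ k : ℕ, Real.log (1 - Real.exp (-(t * (k + 1)))) =
      Real.log t + Real.log ((k : ℝ) + 1) + logQuot (t * (k + 1)) := fun k => by
    rw [← log_add_logQuot (by positivity), Real.log_mul ht.ne' (by positivity)]
  simp only [logPoch, h, Finset.sum_add_distrib, Finset.sum_const, Finset.card_range, nsmul_eq_mul]
  rw [← Real.log_prod (fun i _ => by positivity), ← Finset.prod_range_add_one_eq_factorial]
  push_cast
  rfl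

theorem trapezoidal_logQuot {t : ℝ} {n : ℕ} (hn : 0 < n) :
    trapezoidal_integral logQuot n 0 (t * n) =
      t * (∑ k ∈ Finset.range n, logQuot (t * (k + 1)) - logQuot (t * n) / 2) := by
  obtain ⟨n, rfl⟩ : ∃ m, n = m + 1 := ⟨n - 1, by omega⟩
  have hn' : ((n : ℝ) + 1) ≠ 0 := by positivity
  rw [trapezoidal_integral, logQuot_zero, Finset.sum_range_succ, Nat.add_sub_cancel]
  have : ∀ k : ℕ, (0 : ℝ) + (k + 1) * (t * ((n + 1 : ℕ) : ℝ) - 0) / ((n + 1 : ℕ) : ℝ) =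
      t * (k + 1) := fun k => by
    push_cast
    field_simp
    ring
  simp only [this]
  push_cast
  field_simp
  ring

/-- Stirling's formula for the `q`-factorial with `q = e ^ (-t)`, when `t → 0` and `t n` tends to
a positive limit. -/
theorem tendsto_logPoch_sub {ι : Type*} {l : Filter ι} {t : ι → ℝ} {n : ι → ℕ} {c : ℝ}
    (ht0 : ∀ᶠ i in l, 0 < t i) (ht : Tendsto t l (𝓝 0)) (hc : 0 < c)
    (hn : Tendsto (fun i => t i * n i) l (𝓝 c)) :
    Tendsto (fun i => logPoch (t i) (n i) - (logInt (t i * n i) / t i +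
      Real.log (1 - Real.exp (-(t i * n i))) / 2 + Real.log (2 * Real.pi / t i) / 2)) l (𝓝 0) := by
  have hn0 : ∀ᶠ i in l, 0 < n i := by
    filter_upwards [hn.eventually_const_lt hc] with i hi
    rcases Nat.eq_zero_or_pos (n i) with h | h
    · simp [h] at hi
    · exact h
  have hntop : Tendsto n l atTop := by
    have h1 : Tendsto (fun i => (t i)⁻¹) l atTop :=
      tendsto_inv_nhdsGT_zero.comp (tendsto_nhdsWithin_iff.2 ⟨ht, ht0⟩)
    have h2 : Tendsto (fun i => (t i)⁻¹ * (t i * n i)) l atTop := h1.atTop_mul_pos hc hn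
    rw [← tendsto_natCast_atTop_iff (R := ℝ)]
    refine h2.congr' ?_
    filter_upwards [ht0] with i hi
    field_simp
  obtain ⟨M, hM⟩ := exists_trapezoidal_error_le contDiff_logQuot (c + 1)
  have hstir : Tendsto (fun i => Real.log (Stirling.stirlingSeq (n i)) - Real.log √Real.pi) l
      (𝓝 0) := by
    have := ((Real.continuousAt_log (Real.sqrt_pos.2 Real.pi_pos).ne').tendsto.comp
      (Stirling.tendsto_stirlingSeq_sqrt_pi.comp hntop)).sub_const (Real.log √Real.pi)
    simpa using this
  have herr : Tendsto (fun i => trapezoidal_error logQuot (n i) 0 (t i * n i) / t i) l (𝓝 0) := by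
    have hb : Tendsto (fun i => t i * n i * M * t i / 12) l (𝓝 0) := by
      simpa using ((hn.mul_const M).mul ht).div_const 12
    refine squeeze_zero_norm' ?_ hb
    filter_upwards [ht0, hn0, hn.eventually_lt_const (lt_add_one c)] with i h1 h2 h3
    have h2' : (0 : ℝ) < n i := Nat.cast_pos.2 h2
    have := hM (t i * n i) ⟨by positivity, h3.le⟩ (n i) h2
    rw [Real.norm_eq_abs, abs_div, abs_of_pos h1, div_le_iff₀ h1]
    refine this.trans (le_of_eq ?_)
    field_simp
  have hsum := hstir.add herr
  rw [add_zero] at hsum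
  refine hsum.congr' ?_
  filter_upwards [ht0, hn0] with i h1 h2
  have h2' : (0 : ℝ) < n i := Nat.cast_pos.2 h2
  have hU : 0 < t i * n i := by positivity
  -- both error terms, written out, add up to the difference in the statement
  rw [Stirling.log_stirlingSeq_formula, trapezoidal_error, trapezoidal_logQuot h2,
    logPoch_eq h1, logInt, ← log_add_logQuot hU, Real.log_sqrt Real.pi_pos.le,
    Real.log_mul h1.ne' h2'.ne', Real.log_mul two_ne_zero h2'.ne',
    Real.log_div h2'.ne' (Real.exp_ne_zero _), Real.log_exp,
    Real.log_div (by positivity) h1.ne', Real.log_mul two_ne_zero Real.pi_pos.ne']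
  field_simp
  ring

/-- The powers of `1 - q` cancel in `transition`, so it can be written with the products
`(1 - q) ⋯ (1 - q ^ n)`. -/
theorem log_transition {t : ℝ} (ht : 0 < t) (a b c d : ℕ) :
    Real.log (transition (Real.exp (-t)) a b c d) =
      -(t * b * c) + (logPoch t (a + b) + logPoch t (a + c) + logPoch t (b + d) +
        logPoch t (c + d)) - (logPoch t (a + b + c + d) + logPoch t a + logPoch t b +
        logPoch t c + logPoch t d) := by
  have hq : 0 < Real.exp (-t) := Real.exp_pos _
  have h1 : 0 < 1 - Real.exp (-t) := one_sub_exp_neg_pos ht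
  have key : ∀ n, Real.log (qFact (Real.exp (-t)) n) =
      logPoch t n - n * Real.log (1 - Real.exp (-t)) := fun n => by
    rw [qFact, Real.log_prod (fun k _ => (qInt_pos hq (Nat.succ_pos k)).ne'), logPoch]
    have : ∀ k : ℕ, Real.log (qInt (Real.exp (-t)) (k + 1)) =
        Real.log (1 - Real.exp (-(t * (k + 1)))) - Real.log (1 - Real.exp (-t)) := fun k => by
      have hpos : 0 < 1 - Real.exp (-(t * (k + 1))) := one_sub_exp_neg_pos (by positivity)
      rw [← Real.log_div hpos.ne' h1.ne', qInt, geom_sum_eq (by linarith), ← Real.exp_nat_mul,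
        ← neg_div_neg_eq]
      congr 2
      · push_cast
        rw [neg_sub]
        congr 2
        ring
      · ring
    simp only [this, Finset.sum_sub_distrib, Finset.sum_const, Finset.card_range, nsmul_eq_mul]
  have hF := fun n => (qFact_pos hq n).ne'
  rw [transition, Real.log_div (by simp [hF]) (by simp [hF]),
    Real.log_mul (by positivity) (by simp [hF]), Real.log_mul (by simp [hF]) (hF _),
    Real.log_mul (by simp [hF]) (hF _), Real.log_mul (hF _) (hF _),
    Real.log_mul (hF _) (by simp [hF]), Real.log_mul (by simp [hF]) (hF _),
    Real.log_mul (by simp [hF]) (hF _), Real.log_mul (hF _) (hF _), ← Real.exp_nat_mul,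
    Real.log_exp]
  simp only [key]
  push_cast
  ring

theorem transition_pos {q : ℝ} (hq : 0 < q) (a b c d : ℕ) : 0 < transition q a b c d := by
  have := fun n => qFact_pos hq n
  unfold transition
  have h1 := this a; have h2 := this b; have h3 := this c; have h4 := this d
  have h5 := this (a + b); have h6 := this (a + c); have h7 := this (b + d)
  have h8 := this (c + d); have h9 := this (a + b + c + d)
  positivity

/-! ### The rate function of a transition and its maximum -/

/-- The quantity `e ^ (-k) + e ^ (-l) - e ^ (-(k + l)) - e ^ (-n)`. -/
noncomputable def modeDen (k l n : ℝ) : ℝ :=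
  Real.exp (-k) + Real.exp (-l) - Real.exp (-k) * Real.exp (-l) - Real.exp (-n)

/-- The maximizer of the rate function: the typical value of `t * H_{L, k / t}` given that
`t * H_{L, n / t} = l`. -/
noncomputable def mode (k l n : ℝ) : ℝ :=
  Real.log (1 - Real.exp (-n)) - Real.log (modeDen k l n)

/-- The exponential rate of `transition (e ^ (-t))` at `a = u / t`, `a + b = k / t`, `a + c = l / t`
and `a + b + c + d = n / t`. -/
noncomputable def rate (k l n u : ℝ) : ℝ :=
  -((k - u) * (l - u)) + (logInt k + logInt l + logInt (n - l) + logInt (n - k)) -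
    (logInt n + logInt u + logInt (k - u) + logInt (l - u) + logInt (n - k - l + u))

/-- The derivative of `rate k l n`. -/
noncomputable def rateDeriv (k l n u : ℝ) : ℝ :=
  (k - u) + (l - u) - Real.log (1 - Real.exp (-u)) + Real.log (1 - Real.exp (-(k - u))) +
    Real.log (1 - Real.exp (-(l - u))) - Real.log (1 - Real.exp (-(n - k - l + u)))

/-- The negative of the second derivative of `rate k l n`. -/
noncomputable def curvature (k l n u : ℝ) : ℝ :=
  2 + Real.exp (-u) / (1 - Real.exp (-u)) + Real.exp (-(k - u)) / (1 - Real.exp (-(k - u))) +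
    Real.exp (-(l - u)) / (1 - Real.exp (-(l - u))) +
    Real.exp (-(n - k - l + u)) / (1 - Real.exp (-(n - k - l + u)))

section mode

variable {k l n : ℝ}

theorem modeDen_pos (k : ℝ) (hl : 0 < l) (hln : l < n) :
    0 < modeDen k l n := by
  have h2 : Real.exp (-n) < Real.exp (-l) := by gcongr
  have h3 : Real.exp (-l) < 1 := by simpa using hl
  have : 0 < Real.exp (-k) := Real.exp_pos _
  unfold modeDen
  nlinarith

theorem exp_neg_mode (hl : 0 < l) (hln : l < n) :
    Real.exp (-mode k l n) = modeDen k l n / (1 - Real.exp (-n)) := by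
  rw [mode, neg_sub, Real.exp_sub, Real.exp_log (modeDen_pos k hl hln),
    Real.exp_log (one_sub_exp_neg_pos (by linarith))]

theorem one_sub_exp_neg_mode (hl : 0 < l) (hln : l < n) :
    1 - Real.exp (-mode k l n) =
      (1 - Real.exp (-k)) * (1 - Real.exp (-l)) / (1 - Real.exp (-n)) := by
  have := (one_sub_exp_neg_pos (show 0 < n by linarith)).ne'
  rw [exp_neg_mode hl hln, modeDen]
  field_simp
  ring

theorem exp_neg_left_sub_mode (hl : 0 < l) (hln : l < n) :
    Real.exp (-(k - mode k l n)) = Real.exp (-k) * (1 - Real.exp (-n)) / modeDen k l n := by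
  rw [show -(k - mode k l n) = -k - -mode k l n by ring, Real.exp_sub,
    exp_neg_mode hl hln]
  field_simp

theorem exp_neg_right_sub_mode (hl : 0 < l) (hln : l < n) :
    Real.exp (-(l - mode k l n)) = Real.exp (-l) * (1 - Real.exp (-n)) / modeDen k l n := by
  rw [show -(l - mode k l n) = -l - -mode k l n by ring, Real.exp_sub,
    exp_neg_mode hl hln]
  field_simp

theorem exp_neg_rest_mode (hl : 0 < l) (hln : l < n) :
    Real.exp (-(n - k - l + mode k l n)) =
      Real.exp (-n) * modeDen k l n /
        (Real.exp (-k) * Real.exp (-l) * (1 - Real.exp (-n))) := by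
  rw [show -(n - k - l + mode k l n) = -n + -mode k l n - (-k + -l) by ring, Real.exp_sub,
    Real.exp_add, Real.exp_add, exp_neg_mode hl hln]
  field_simp

theorem one_sub_exp_neg_left_sub_mode (hl : 0 < l) (hln : l < n) :
    1 - Real.exp (-(k - mode k l n)) =
      (Real.exp (-l) - Real.exp (-n)) * (1 - Real.exp (-k)) / modeDen k l n := by
  have := (modeDen_pos k hl hln).ne'
  rw [exp_neg_left_sub_mode hl hln]
  field_simp
  rw [modeDen]
  ring

theorem one_sub_exp_neg_right_sub_mode (hl : 0 < l) (hln : l < n) :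
    1 - Real.exp (-(l - mode k l n)) =
      (Real.exp (-k) - Real.exp (-n)) * (1 - Real.exp (-l)) / modeDen k l n := by
  have := (modeDen_pos k hl hln).ne'
  rw [exp_neg_right_sub_mode hl hln]
  field_simp
  rw [modeDen]
  ring

theorem one_sub_exp_neg_rest_mode (hl : 0 < l) (hln : l < n) :
    1 - Real.exp (-(n - k - l + mode k l n)) =
      (Real.exp (-k) - Real.exp (-n)) * (Real.exp (-l) - Real.exp (-n)) /
        (Real.exp (-k) * Real.exp (-l) * (1 - Real.exp (-n))) := by
  have := (one_sub_exp_neg_pos (show 0 < n by linarith)).ne'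
  rw [exp_neg_rest_mode hl hln]
  field_simp
  rw [modeDen]
  ring

theorem pos_of_one_sub_exp_neg_pos {u : ℝ} (h : 0 < 1 - Real.exp (-u)) : 0 < u := by
  simpa using h

theorem mode_pos (hk : 0 < k) (hl : 0 < l) (hln : l < n) : 0 < mode k l n := by
  apply pos_of_one_sub_exp_neg_pos
  rw [one_sub_exp_neg_mode hl hln]
  have := one_sub_exp_neg_pos hk
  have := one_sub_exp_neg_pos hl
  have := one_sub_exp_neg_pos (hl.trans hln)
  positivity

theorem mode_lt_left (hk : 0 < k) (hl : 0 < l) (hln : l < n) :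
    0 < k - mode k l n := by
  apply pos_of_one_sub_exp_neg_pos
  rw [one_sub_exp_neg_left_sub_mode hl hln]
  have := one_sub_exp_neg_pos hk
  have := modeDen_pos k hl hln
  have : 0 < Real.exp (-l) - Real.exp (-n) := sub_pos.2 (by gcongr)
  positivity

theorem mode_lt_right (hkn : k < n) (hl : 0 < l) (hln : l < n) :
    0 < l - mode k l n := by
  apply pos_of_one_sub_exp_neg_pos
  rw [one_sub_exp_neg_right_sub_mode hl hln]
  have := one_sub_exp_neg_pos hl
  have := modeDen_pos k hl hln
  have : 0 < Real.exp (-k) - Real.exp (-n) := sub_pos.2 (by gcongr)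
  positivity

theorem rest_mode_pos (hkn : k < n) (hl : 0 < l) (hln : l < n) :
    0 < n - k - l + mode k l n := by
  apply pos_of_one_sub_exp_neg_pos
  rw [one_sub_exp_neg_rest_mode hl hln]
  have := one_sub_exp_neg_pos (hl.trans hln)
  have : 0 < Real.exp (-k) - Real.exp (-n) := sub_pos.2 (by gcongr)
  have : 0 < Real.exp (-l) - Real.exp (-n) := sub_pos.2 (by gcongr)
  positivity

/-- The four factors at `mode` balance; this is the stationarity of `rate` there. -/
theorem rateDeriv_mode (hk : 0 < k) (hkn : k < n) (hl : 0 < l) (hln : l < n) :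
    rateDeriv k l n (mode k l n) = 0 := by
  have hA := one_sub_exp_neg_pos (mode_pos hk hl hln)
  have hB := one_sub_exp_neg_pos (mode_lt_left hk hl hln)
  have hC := one_sub_exp_neg_pos (mode_lt_right hkn hl hln)
  have hD := one_sub_exp_neg_pos (rest_mode_pos hkn hl hln)
  have h1 := one_sub_exp_neg_pos hk
  have h2 := one_sub_exp_neg_pos hl
  have h3 := one_sub_exp_neg_pos (hl.trans hln)
  have hT := modeDen_pos k hl hln
  have key : (1 - Real.exp (-(k - mode k l n))) * (1 - Real.exp (-(l - mode k l n))) =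
      Real.exp (-(k - mode k l n)) * Real.exp (-(l - mode k l n)) *
        ((1 - Real.exp (-mode k l n)) * (1 - Real.exp (-(n - k - l + mode k l n)))) := by
    rw [one_sub_exp_neg_left_sub_mode hl hln,
      one_sub_exp_neg_right_sub_mode hl hln, one_sub_exp_neg_mode hl hln,
      one_sub_exp_neg_rest_mode hl hln, exp_neg_left_sub_mode hl hln,
      exp_neg_right_sub_mode hl hln]
    field_simp
  have := congrArg Real.log key
  rw [Real.log_mul hB.ne' hC.ne', Real.log_mul (by positivity) (by positivity),
    Real.log_mul (by positivity) (by positivity), Real.log_mul hA.ne' hD.ne', Real.log_exp,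
    Real.log_exp] at this
  rw [rateDeriv]
  linarith

theorem hasDerivAt_rate {u : ℝ} (hu : 0 < u) (hku : 0 < k - u) (hlu : 0 < l - u)
    (hd : 0 < n - k - l + u) : HasDerivAt (rate k l n) (rateDeriv k l n u) u := by
  have e1 : HasDerivAt (fun u => k - u) (-1) u := by simpa using (hasDerivAt_id u).const_sub k
  have e2 : HasDerivAt (fun u => l - u) (-1) u := by simpa using (hasDerivAt_id u).const_sub l
  have e3 : HasDerivAt (fun u => n - k - l + u) 1 u := by
    simpa using (hasDerivAt_id u).const_add (n - k - l)
  have h1 := hasDerivAt_logInt hu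
  have h2 := (hasDerivAt_logInt hku).comp u e1
  have h3 := (hasDerivAt_logInt hlu).comp u e2
  have h4 := (hasDerivAt_logInt hd).comp u e3
  have h5 := ((e1.mul e2).neg.add_const
    (logInt k + logInt l + logInt (n - l) + logInt (n - k))).sub
    ((((h1.const_add (logInt n)).add h2).add h3).add h4)
  convert! h5 using 1
  rw [rateDeriv]
  ring

theorem hasDerivAt_log_one_sub_exp_neg {u : ℝ} (hu : 0 < u) :
    HasDerivAt (fun u => Real.log (1 - Real.exp (-u))) (Real.exp (-u) / (1 - Real.exp (-u))) u :=
  (hasDerivAt_one_sub_exp_neg u).log (one_sub_exp_neg_pos hu).ne'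

theorem hasDerivAt_rateDeriv {u : ℝ} (hu : 0 < u) (hku : 0 < k - u) (hlu : 0 < l - u)
    (hd : 0 < n - k - l + u) : HasDerivAt (rateDeriv k l n) (-curvature k l n u) u := by
  have e1 : HasDerivAt (fun u => k - u) (-1) u := by simpa using (hasDerivAt_id u).const_sub k
  have e2 : HasDerivAt (fun u => l - u) (-1) u := by simpa using (hasDerivAt_id u).const_sub l
  have e3 : HasDerivAt (fun u => n - k - l + u) 1 u := by
    simpa using (hasDerivAt_id u).const_add (n - k - l)
  have h1 := hasDerivAt_log_one_sub_exp_neg hu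
  have h2 := (hasDerivAt_log_one_sub_exp_neg hku).comp u e1
  have h3 := (hasDerivAt_log_one_sub_exp_neg hlu).comp u e2
  have h4 := (hasDerivAt_log_one_sub_exp_neg hd).comp u e3
  have h5 := ((((e1.add e2).sub h1).add h2).add h3).sub h4
  convert! h5 using 1
  rw [curvature]
  ring

/-- At the maximum, the curvature collapses to a product. -/
theorem curvature_mode (hk : 0 < k) (hkn : k < n) (hl : 0 < l) (hln : l < n) :
    curvature k l n (mode k l n) = (1 - Real.exp (-n)) /
      ((1 - Real.exp (-(k - mode k l n))) * (1 - Real.exp (-(l - mode k l n)))) := by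
  have h1 := one_sub_exp_neg_pos hk
  have h2 := one_sub_exp_neg_pos hl
  have h3 := one_sub_exp_neg_pos (hl.trans hln)
  have h4 : 0 < Real.exp (-k) - Real.exp (-n) := sub_pos.2 (by gcongr)
  have h5 : 0 < Real.exp (-l) - Real.exp (-n) := sub_pos.2 (by gcongr)
  have hT := modeDen_pos k hl hln
  rw [curvature, one_sub_exp_neg_left_sub_mode hl hln,
      one_sub_exp_neg_right_sub_mode hl hln, one_sub_exp_neg_mode hl hln,
      one_sub_exp_neg_rest_mode hl hln, exp_neg_left_sub_mode hl hln,
      exp_neg_right_sub_mode hl hln, exp_neg_mode hl hln,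
      exp_neg_rest_mode hl hln]
  field_simp
  rw [modeDen]
  ring

theorem mode_zero (l n : ℝ) : mode 0 l n = 0 := by
  simp [mode, modeDen]

theorem differentiableAt_mode (hl : 0 < l) (hln : l < n) :
    DifferentiableAt ℝ (fun k => mode k l n) k := by
  have := (modeDen_pos k hl hln).ne'
  have hd : DifferentiableAt ℝ (fun k => modeDen k l n) k := by
    unfold modeDen
    fun_prop
  exact (hd.log this).const_sub _

/-- The maximum of the rate function is `0`: the maximal value is constant in `k`, because both
the derivative along `u` and the one along `k` vanish at the maximizer, and it vanishes for
`k = 0`. -/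
theorem rate_mode (hk : 0 < k) (hkn : k < n) (hl : 0 < l) (hln : l < n) :
    rate k l n (mode k l n) = 0 := by
  have hcont : ContinuousOn (fun k => rate k l n (mode k l n)) (Set.Icc 0 k) := by
    intro κ hκ
    have hm : ContinuousAt (fun k => mode k l n) κ :=
      (differentiableAt_mode hl hln).continuousAt
    have hG : ∀ {F : ℝ → ℝ}, ContinuousAt F κ → ContinuousAt (fun k => logInt (F k)) κ :=
      fun hF => continuous_logInt.continuousAt.comp hF
    refine ContinuousAt.continuousWithinAt ?_
    unfold rate
    have hid : ContinuousAt (fun k : ℝ => k) κ := continuousAt_id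
    have hc : ∀ c : ℝ, ContinuousAt (fun _ : ℝ => c) κ := fun c => continuousAt_const
    exact ((((hid.sub hm).mul ((hc l).sub hm)).neg.add
      ((((hG hid).add (hc _)).add (hc _)).add (hG ((hc n).sub hid))))).sub
      (((((hc _).add (hG hm)).add (hG (hid.sub hm))).add (hG ((hc l).sub hm))).add
        (hG ((((hc n).sub hid).sub (hc l)).add hm)))
  have hderiv : ∀ κ ∈ Set.Ioo 0 k,
      HasDerivAt (fun k => rate k l n (mode k l n)) 0 κ := by
    intro κ hκ
    have hκ0 : 0 < κ := hκ.1
    have hκn : κ < n := hκ.2.trans hkn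
    obtain ⟨e, he⟩ : ∃ e, HasDerivAt (fun k => mode k l n) e κ :=
      ⟨_, (differentiableAt_mode hl hln).hasDerivAt⟩
    have hid := hasDerivAt_id' κ
    have d1 : HasDerivAt (fun k => k - mode k l n) (1 - e) κ := hid.sub he
    have d2 := he.const_sub l
    have d3 : HasDerivAt (fun k => n - k - l + mode k l n) (-1 + e) κ :=
      ((hid.const_sub n).sub_const l).add he
    have hA := mode_pos hκ0 hl hln
    have hB := mode_lt_left hκ0 hl hln
    have hC := mode_lt_right hκn hl hln
    have hD := rest_mode_pos hκn hl hln
    have g1 := hasDerivAt_logInt hκ0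
    have g2 := (hasDerivAt_logInt (sub_pos.2 hκn)).comp κ (hid.const_sub n)
    have g3 := (hasDerivAt_logInt hA).comp κ he
    have g4 := (hasDerivAt_logInt hB).comp κ d1
    have g5 := (hasDerivAt_logInt hC).comp κ d2
    have g6 := (hasDerivAt_logInt hD).comp κ d3
    have key := ((d1.mul d2).neg.add
      (((g1.add_const (logInt l)).add_const (logInt (n - l))).add g2)).sub
      ((((g3.const_add (logInt n)).add g4).add g5).add g6)
    have hstat := rateDeriv_mode hκ0 hκn hl hln
    -- the derivative in `k` with `u` held fixed
    have hstat' : Real.log (1 - Real.exp (-κ)) - Real.log (1 - Real.exp (-(n - κ))) -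
        (l - mode κ l n) - Real.log (1 - Real.exp (-(κ - mode κ l n))) +
        Real.log (1 - Real.exp (-(n - κ - l + mode κ l n))) = 0 := by
      have p1 := one_sub_exp_neg_pos hκ0
      have p2 := one_sub_exp_neg_pos (sub_pos.2 hκn)
      have pB := one_sub_exp_neg_pos hB
      have pD := one_sub_exp_neg_pos hD
      have h3 := one_sub_exp_neg_pos (hl.trans hln)
      have hT := modeDen_pos κ hl hln
      have hprod : (1 - Real.exp (-κ)) * (1 - Real.exp (-(n - κ - l + mode κ l n))) *
          Real.exp (-(l - mode κ l n)) =
          (1 - Real.exp (-(n - κ))) * (1 - Real.exp (-(κ - mode κ l n))) := by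
        rw [one_sub_exp_neg_rest_mode hl hln,
          exp_neg_right_sub_mode hl hln,
          one_sub_exp_neg_left_sub_mode hl hln,
          show -(n - κ) = -n - -κ by ring, Real.exp_sub]
        field_simp
      have := congrArg Real.log hprod
      rw [Real.log_mul (by positivity) (by positivity), Real.log_mul p1.ne' pD.ne',
        Real.log_mul p2.ne' pB.ne', Real.log_exp] at this
      linarith
    rw [rateDeriv] at hstat
    convert! key using 1
    linear_combination (-1 : ℝ) * hstat' - e * hstat
  obtain ⟨c, -, hc⟩ := exists_hasDerivAt_eq_slope _ _ hk hcont hderiv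
  have h0 : rate 0 l n (mode 0 l n) = 0 := by
    rw [mode_zero, rate]
    simp only [sub_zero, add_zero, logInt_zero]
    ring
  rw [eq_div_iff (by linarith)] at hc
  linarith

end mode

/-- Second-order Taylor expansion at a critical zero `a`, to the right of `a`. -/
theorem exists_eq_half_mul_sq_of_lt {f f' f'' : ℝ → ℝ} {a b : ℝ} (hab : a < b)
    (hf : ∀ u ∈ Set.Icc a b, HasDerivAt f (f' u) u)
    (hf' : ∀ u ∈ Set.Icc a b, HasDerivAt f' (f'' u) u) (h0 : f a = 0) (h1 : f' a = 0) :
    ∃ ξ ∈ Set.Icc a b, f b = f'' ξ / 2 * (b - a) ^ 2 := by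
  have hg : ∀ u, HasDerivAt (fun u => (u - a) ^ 2) (2 * (u - a)) u := fun u => by
    have := ((hasDerivAt_id' u).sub_const a).pow 2
    convert! this using 1
    simp
  obtain ⟨c, hc, hce⟩ := exists_ratio_hasDerivAt_eq_ratio_slope f f' hab
    (fun u hu => (hf u hu).continuousAt.continuousWithinAt)
    (fun u hu => hf u ⟨hu.1.le, hu.2.le⟩) (fun u => (u - a) ^ 2) (fun u => 2 * (u - a))
    (fun u _ => (hg u).continuousAt.continuousWithinAt) (fun u _ => hg u)
  obtain ⟨ξ, hξ, hξe⟩ := exists_hasDerivAt_eq_slope f' f'' hc.1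
    (fun u hu => (hf' u ⟨hu.1, hu.2.trans hc.2.le⟩).continuousAt.continuousWithinAt)
    (fun u hu => hf' u ⟨hu.1.le, hu.2.le.trans hc.2.le⟩)
  refine ⟨ξ, ⟨hξ.1.le, hξ.2.le.trans hc.2.le⟩, ?_⟩
  have hca : c - a ≠ 0 := (sub_pos.2 hc.1).ne'
  rw [h1, sub_zero, eq_div_iff hca] at hξe
  simp only [sub_self, h0, sub_zero, ne_eq, OfNat.ofNat_ne_zero, not_false_eq_true, zero_pow,
    ← hξe] at hce
  have : (c - a) * ((b - a) ^ 2 * f'' ξ) = (c - a) * (2 * f b) := by linarith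
  have := mul_left_cancel₀ hca this
  linarith

/-- Second-order Taylor expansion at a critical zero `a`. -/
theorem exists_eq_half_mul_sq {f f' f'' : ℝ → ℝ} {a b : ℝ}
    (hf : ∀ u ∈ Set.uIcc a b, HasDerivAt f (f' u) u)
    (hf' : ∀ u ∈ Set.uIcc a b, HasDerivAt f' (f'' u) u) (h0 : f a = 0) (h1 : f' a = 0) :
    ∃ ξ ∈ Set.uIcc a b, f b = f'' ξ / 2 * (b - a) ^ 2 := by
  rcases lt_trichotomy a b with h | rfl | h
  · rw [Set.uIcc_of_lt h] at *
    exact exists_eq_half_mul_sq_of_lt h hf hf' h0 h1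
  · exact ⟨a, by simp, by simp [h0]⟩
  · rw [Set.uIcc_of_gt h] at *
    have hneg : ∀ u ∈ Set.Icc (-a) (-b), -u ∈ Set.Icc b a := fun u hu =>
      ⟨by linarith [hu.2], by linarith [hu.1]⟩
    obtain ⟨ξ, hξ, he⟩ := exists_eq_half_mul_sq_of_lt (f := fun u => f (-u))
      (f' := fun u => -f' (-u)) (f'' := fun u => f'' (-u)) (neg_lt_neg h)
      (fun u hu => by
        convert! (hf _ (hneg u hu)).comp u (hasDerivAt_neg u) using 1
        ring)
      (fun u hu => by
        convert! ((hf' _ (hneg u hu)).comp u (hasDerivAt_neg u)).neg using 1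
        ring)
      (by simpa using h0) (by simpa using h1)
    refine ⟨-ξ, hneg ξ hξ, ?_⟩
    simp only [neg_neg] at he
    rw [he]
    ring

/-- The rate function is quadratic near its maximum. -/
theorem exists_rate_eq {k l n u : ℝ} (hk : 0 < k) (hkn : k < n) (hl : 0 < l) (hln : l < n)
    (hu : 0 < u) (hku : 0 < k - u) (hlu : 0 < l - u) (hd : 0 < n - k - l + u) :
    ∃ ξ ∈ Set.uIcc (mode k l n) u,
      rate k l n u = -curvature k l n ξ / 2 * (u - mode k l n) ^ 2 := by
  have hA := mode_pos hk hl hln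
  have hB := mode_lt_left hk hl hln
  have hC := mode_lt_right hkn hl hln
  have hD := rest_mode_pos hkn hl hln
  have hmem : ∀ v ∈ Set.uIcc (mode k l n) u,
      0 < v ∧ 0 < k - v ∧ 0 < l - v ∧ 0 < n - k - l + v := fun v hv => by
    rcases Set.mem_uIcc.1 hv with ⟨h1, h2⟩ | ⟨h1, h2⟩ <;>
    exact ⟨by linarith, by linarith, by linarith, by linarith⟩
  exact exists_eq_half_mul_sq
    (fun v hv => hasDerivAt_rate (hmem v hv).1 (hmem v hv).2.1 (hmem v hv).2.2.1 (hmem v hv).2.2.2)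
    (fun v hv => hasDerivAt_rateDeriv (hmem v hv).1 (hmem v hv).2.1 (hmem v hv).2.2.1
      (hmem v hv).2.2.2)
    (rate_mode hk hkn hl hln) (rateDeriv_mode hk hkn hl hln)

/-! ### The local limit theorem for one transition -/

theorem tendsto_log_one_sub_exp_neg {ι : Type*} {L : Filter ι} {u : ι → ℝ} {U : ℝ} (hU : 0 < U)
    (hu : Tendsto u L (𝓝 U)) :
    Tendsto (fun i => Real.log (1 - Real.exp (-u i))) L (𝓝 (Real.log (1 - Real.exp (-U)))) :=
  (hasDerivAt_log_one_sub_exp_neg hU).continuousAt.tendsto.comp hu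

theorem tendsto_mode {ι : Type*} {L : Filter ι} {k l n : ι → ℝ} {k₀ l₀ n₀ : ℝ}
    (hl : 0 < l₀) (hln : l₀ < n₀) (hk' : Tendsto k L (𝓝 k₀))
    (hl' : Tendsto l L (𝓝 l₀)) (hn' : Tendsto n L (𝓝 n₀)) :
    Tendsto (fun i => mode (k i) (l i) (n i)) L (𝓝 (mode k₀ l₀ n₀)) := by
  have e : ∀ {u : ι → ℝ} {U : ℝ}, Tendsto u L (𝓝 U) →
      Tendsto (fun i => Real.exp (-u i)) L (𝓝 (Real.exp (-U))) := fun h =>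
    (Real.continuous_exp.tendsto _).comp h.neg
  refine (tendsto_log_one_sub_exp_neg (hl.trans hln) hn').sub ?_
  refine Tendsto.log ?_ (modeDen_pos k₀ hl hln).ne'
  exact (((e hk').add (e hl')).sub ((e hk').mul (e hl'))).sub (e hn')

theorem tendsto_curvature {ι : Type*} {L : Filter ι} {k l n u : ι → ℝ} {k₀ l₀ n₀ u₀ : ℝ}
    (hu : 0 < u₀) (hku : 0 < k₀ - u₀) (hlu : 0 < l₀ - u₀) (hd : 0 < n₀ - k₀ - l₀ + u₀)
    (hk' : Tendsto k L (𝓝 k₀)) (hl' : Tendsto l L (𝓝 l₀)) (hn' : Tendsto n L (𝓝 n₀))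
    (hu' : Tendsto u L (𝓝 u₀)) :
    Tendsto (fun i => curvature (k i) (l i) (n i) (u i)) L (𝓝 (curvature k₀ l₀ n₀ u₀)) := by
  have e : ∀ {u : ι → ℝ} {U : ℝ}, 0 < U → Tendsto u L (𝓝 U) →
      Tendsto (fun i => Real.exp (-u i) / (1 - Real.exp (-u i))) L
        (𝓝 (Real.exp (-U) / (1 - Real.exp (-U)))) := fun hU h => by
    have := (Real.continuous_exp.tendsto _).comp h.neg
    exact this.div (this.const_sub 1) (one_sub_exp_neg_pos hU).ne'
  exact (((tendsto_const_nhds.add (e hu hu')).add (e hku (hk'.sub hu'))).add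
    (e hlu (hl'.sub hu'))).add (e hd (((hn'.sub hk').sub hl').add hu'))

/-- If `u i` maximizes the rate up to an error of order `√(t i)`, the rate at `u i` is of order
`t i`. -/
theorem tendsto_rate_div {ι : Type*} {L : Filter ι} {t k l n u : ι → ℝ} {k₀ l₀ n₀ δ : ℝ}
    (ht0 : ∀ᶠ i in L, 0 < t i) (ht : Tendsto t L (𝓝 0))
    (hk : 0 < k₀) (hkn : k₀ < n₀) (hl : 0 < l₀) (hln : l₀ < n₀) (hk' : Tendsto k L (𝓝 k₀))
    (hl' : Tendsto l L (𝓝 l₀)) (hn' : Tendsto n L (𝓝 n₀))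
    (hδ : Tendsto (fun i => (u i - mode (k i) (l i) (n i)) / √(t i)) L (𝓝 δ)) :
    Tendsto u L (𝓝 (mode k₀ l₀ n₀)) ∧
    Tendsto (fun i => rate (k i) (l i) (n i) (u i) / t i) L
      (𝓝 (-curvature k₀ l₀ n₀ (mode k₀ l₀ n₀) / 2 * δ ^ 2)) := by
  have hm := tendsto_mode hl hln hk' hl' hn'
  have hA := mode_pos hk hl hln
  have hB := mode_lt_left hk hl hln
  have hC := mode_lt_right hkn hl hln
  have hD := rest_mode_pos hkn hl hln
  have hu' : Tendsto u L (𝓝 (mode k₀ l₀ n₀)) := by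
    have h1 : Tendsto (fun i => √(t i)) L (𝓝 0) := by
      have := (Real.continuous_sqrt.tendsto 0).comp ht
      rwa [Real.sqrt_zero] at this
    have h2 := (hδ.mul h1).add hm
    rw [mul_zero, zero_add] at h2
    refine h2.congr' ?_
    filter_upwards [ht0] with i hi
    have := (Real.sqrt_pos.2 hi).ne'
    field_simp
    ring
  refine ⟨hu', ?_⟩
  -- intermediate points of the Taylor expansions, chosen for all `i` at once
  have hex : ∀ i, ∃ ξ, 0 < k i → k i < n i → 0 < l i → l i < n i → 0 < u i → 0 < k i - u i →
      0 < l i - u i → 0 < n i - k i - l i + u i → (ξ ∈ Set.uIcc (mode (k i) (l i) (n i)) (u i) ∧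
      rate (k i) (l i) (n i) (u i) =
        -curvature (k i) (l i) (n i) ξ / 2 * (u i - mode (k i) (l i) (n i)) ^ 2) := by
    intro i
    by_cases h : 0 < k i ∧ k i < n i ∧ 0 < l i ∧ l i < n i ∧ 0 < u i ∧ 0 < k i - u i ∧
      0 < l i - u i ∧ 0 < n i - k i - l i + u i
    · obtain ⟨h1, h2, h3, h4, h5, h6, h7, h8⟩ := h
      obtain ⟨ξ, hξ⟩ := exists_rate_eq h1 h2 h3 h4 h5 h6 h7 h8
      exact ⟨ξ, fun _ _ _ _ _ _ _ _ => hξ⟩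
    · -- irrelevant value: the conditions hold eventually along `L`
      exact ⟨0, fun h1 h2 h3 h4 h5 h6 h7 h8 => (h ⟨h1, h2, h3, h4, h5, h6, h7, h8⟩).elim⟩
  choose ξ hξ using hex
  have hev : ∀ᶠ i in L, ξ i ∈ Set.uIcc (mode (k i) (l i) (n i)) (u i) ∧
      rate (k i) (l i) (n i) (u i) =
        -curvature (k i) (l i) (n i) (ξ i) / 2 * (u i - mode (k i) (l i) (n i)) ^ 2 := by
    filter_upwards [hk'.eventually_const_lt hk, hk'.eventually_lt hn' hkn,
      hl'.eventually_const_lt hl, hl'.eventually_lt hn' hln, hu'.eventually_const_lt hA,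
      (hk'.sub hu').eventually_const_lt hB, (hl'.sub hu').eventually_const_lt hC,
      (((hn'.sub hk').sub hl').add hu').eventually_const_lt hD] with i h1 h2 h3 h4 h5 h6 h7 h8
      using hξ i h1 h2 h3 h4 h5 h6 h7 h8
  have hξ' : Tendsto ξ L (𝓝 (mode k₀ l₀ n₀)) := by
    have h1 := hm.min hu'
    have h2 := hm.max hu'
    rw [min_self] at h1
    rw [max_self] at h2
    exact tendsto_of_tendsto_of_tendsto_of_le_of_le' h1 h2 (hev.mono fun i hi => hi.1.1)
      (hev.mono fun i hi => hi.1.2)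
  have hcurv := tendsto_curvature hA hB hC hD hk' hl' hn' hξ'
  refine ((hcurv.neg.div_const 2).mul (hδ.pow 2)).congr' ?_
  filter_upwards [hev, ht0] with i hi hti
  rw [hi.2, div_pow, Real.sq_sqrt hti.le]
  ring

/-- The Gaussian local limit theorem for a `q`-hypergeometric transition with `q = e ^ (-t)`. -/
theorem tendsto_transition {ι : Type*} {L : Filter ι} [L.NeBot] {t : ι → ℝ} {a b c d : ι → ℕ}
    {A B C D δ : ℝ} (ht0 : ∀ᶠ i in L, 0 < t i) (ht : Tendsto t L (𝓝 0))
    (hA : 0 < A) (hB : 0 < B) (hC : 0 < C) (hD : 0 < D)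
    (ha : Tendsto (fun i => t i * a i) L (𝓝 A)) (hb : Tendsto (fun i => t i * b i) L (𝓝 B))
    (hc : Tendsto (fun i => t i * c i) L (𝓝 C)) (hd : Tendsto (fun i => t i * d i) L (𝓝 D))
    (hδ : Tendsto (fun i => (t i * a i - mode (t i * a i + t i * b i) (t i * a i + t i * c i)
      (t i * a i + t i * b i + t i * c i + t i * d i)) / √(t i)) L (𝓝 δ)) :
    Tendsto (fun i => transition (Real.exp (-t i)) (a i) (b i) (c i) (d i) / √(t i)) L
      (𝓝 (√((1 - Real.exp (-(A + B + C + D))) /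
        ((1 - Real.exp (-B)) * (1 - Real.exp (-C))) / (2 * Real.pi)) *
        Real.exp (-((1 - Real.exp (-(A + B + C + D))) /
        ((1 - Real.exp (-B)) * (1 - Real.exp (-C)))) * δ ^ 2 / 2))) := by
  set V := (1 - Real.exp (-(A + B + C + D))) / ((1 - Real.exp (-B)) * (1 - Real.exp (-C))) with hV
  have hk0 : 0 < A + B := by linarith
  have hkn : A + B < A + B + C + D := by linarith
  have hl0 : 0 < A + C := by linarith
  have hln : A + C < A + B + C + D := by linarith
  have hS0 : 0 < A + B + C + D := by linarith
  obtain ⟨hu, hrate⟩ := tendsto_rate_div ht0 ht hk0 hkn hl0 hln (ha.add hb) (ha.add hc)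
    (((ha.add hb).add hc).add hd) hδ
  -- `hδ` forces the limit point to be the maximizer
  have hmode : mode (A + B) (A + C) (A + B + C + D) = A := tendsto_nhds_unique hu ha
  have hVpos : 0 < V := by
    have h1 := one_sub_exp_neg_pos hS0
    have h2 := one_sub_exp_neg_pos hB
    have h3 := one_sub_exp_neg_pos hC
    positivity
  have hcurv : curvature (A + B) (A + C) (A + B + C + D) A = V := by
    have := curvature_mode hk0 hkn hl0 hln
    rw [hmode, show A + B - A = B by ring, show A + C - A = C by ring] at this
    exact this
  rw [hmode, hcurv] at hrate
  -- the product of the square root factors in Stirling's formula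
  have hlogV : Real.log (1 - Real.exp (-(A + B))) + Real.log (1 - Real.exp (-(A + C))) +
      Real.log (1 - Real.exp (-(B + D))) + Real.log (1 - Real.exp (-(C + D))) -
      (Real.log (1 - Real.exp (-(A + B + C + D))) + Real.log (1 - Real.exp (-A)) +
        Real.log (1 - Real.exp (-B)) + Real.log (1 - Real.exp (-C)) +
        Real.log (1 - Real.exp (-D))) = Real.log V := by
    have pA := one_sub_exp_neg_pos hA
    have pB := one_sub_exp_neg_pos hB
    have pC := one_sub_exp_neg_pos hC
    have pD := one_sub_exp_neg_pos hD
    have pS := one_sub_exp_neg_pos hS0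
    have pAB := one_sub_exp_neg_pos hk0
    have pAC := one_sub_exp_neg_pos hl0
    have pBD := one_sub_exp_neg_pos (show 0 < B + D by linarith)
    have pCD := one_sub_exp_neg_pos (show 0 < C + D by linarith)
    have e1 : (1 - Real.exp (-(A + B))) * (1 - Real.exp (-(A + C))) =
        (1 - Real.exp (-(A + B + C + D))) * (1 - Real.exp (-A)) := by
      have := one_sub_exp_neg_mode (k := A + B) hl0 hln
      rw [hmode] at this
      rw [this]
      field_simp
    have e2 : (1 - Real.exp (-(B + D))) * (1 - Real.exp (-(C + D))) =
        (1 - Real.exp (-(A + B + C + D))) * (1 - Real.exp (-D)) := by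
      have := one_sub_exp_neg_rest_mode (k := A + B) hl0 hln
      rw [hmode, show A + B + C + D - (A + B) - (A + C) + A = D by ring] at this
      rw [this, show -(B + D) = -(A + B + C + D) - -(A + C) by ring,
        show -(C + D) = -(A + B + C + D) - -(A + B) by ring, Real.exp_sub, Real.exp_sub]
      field_simp
    have f1 := congrArg Real.log e1
    have f2 := congrArg Real.log e2
    rw [Real.log_mul pAB.ne' pAC.ne', Real.log_mul pS.ne' pA.ne'] at f1
    rw [Real.log_mul pBD.ne' pCD.ne', Real.log_mul pS.ne' pD.ne'] at f2
    rw [hV, Real.log_div pS.ne' (by positivity), Real.log_mul pB.ne' pC.ne']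
    linarith
  have cast2 : ∀ {m n : ι → ℕ} {M N : ℝ}, Tendsto (fun i => t i * m i) L (𝓝 M) →
      Tendsto (fun i => t i * n i) L (𝓝 N) →
      Tendsto (fun i => t i * ((m i + n i : ℕ) : ℝ)) L (𝓝 (M + N)) := fun hm hn => by
    simpa only [Nat.cast_add, mul_add] using hm.add hn
  have hab := cast2 ha hb
  have hac := cast2 ha hc
  have hbd := cast2 hb hd
  have hcd := cast2 hc hd
  have hS := cast2 (cast2 hab hc) hd
  have hBD0 : 0 < B + D := by linarith
  have hCD0 : 0 < C + D := by linarith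
  have hE := (((((tendsto_logPoch_sub ht0 ht hk0 hab).add (tendsto_logPoch_sub ht0 ht hl0 hac)).add
    (tendsto_logPoch_sub ht0 ht hBD0 hbd)).add (tendsto_logPoch_sub ht0 ht hCD0 hcd)).sub
    (((((tendsto_logPoch_sub ht0 ht hS0 hS).add (tendsto_logPoch_sub ht0 ht hA ha)).add
    (tendsto_logPoch_sub ht0 ht hB hb)).add (tendsto_logPoch_sub ht0 ht hC hc)).add
    (tendsto_logPoch_sub ht0 ht hD hd)))
  have hLf := ((((tendsto_log_one_sub_exp_neg hk0 hab).add
    (tendsto_log_one_sub_exp_neg hl0 hac)).add (tendsto_log_one_sub_exp_neg hBD0 hbd)).add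
    (tendsto_log_one_sub_exp_neg hCD0 hcd)).sub
    (((((tendsto_log_one_sub_exp_neg hS0 hS).add (tendsto_log_one_sub_exp_neg hA ha)).add
    (tendsto_log_one_sub_exp_neg hB hb)).add (tendsto_log_one_sub_exp_neg hC hc)).add
    (tendsto_log_one_sub_exp_neg hD hd))
  rw [hlogV] at hLf
  have hall := ((hE.add hrate).add (hLf.div_const 2)).sub_const (Real.log (2 * Real.pi) / 2)
  have hlim : √(V / (2 * Real.pi)) * Real.exp (-V * δ ^ 2 / 2) =
      Real.exp (0 + 0 + 0 + 0 - (0 + 0 + 0 + 0 + 0) + -V / 2 * δ ^ 2 + Real.log V / 2 -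
        Real.log (2 * Real.pi) / 2) := by
    have h1 : √(V / (2 * Real.pi)) = Real.exp (Real.log V / 2 - Real.log (2 * Real.pi) / 2) := by
      rw [← sub_div, ← Real.log_div hVpos.ne' (by positivity), Real.exp_half,
        Real.exp_log (by positivity)]
    rw [h1, ← Real.exp_add]
    congr 1
    ring
  rw [hlim]
  refine ((Real.continuous_exp.tendsto _).comp hall).congr' ?_
  filter_upwards [ht0] with i hi
  have hst := Real.sqrt_pos.2 hi
  have htr := transition_pos (Real.exp_pos (-t i)) (a i) (b i) (c i) (d i)
  rw [Function.comp_apply, ← Real.exp_log (div_pos htr hst)]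
  congr 1
  rw [Real.log_div htr.ne' hst.ne', log_transition hi, Real.log_sqrt hi.le, rate,
    Real.log_div (by positivity) hi.ne']
  have r1 : t i * a i + t i * b i = t i * ((a i + b i : ℕ) : ℝ) := by push_cast; ring
  have r2 : t i * a i + t i * c i = t i * ((a i + c i : ℕ) : ℝ) := by push_cast; ring
  have r3 : t i * a i + t i * b i + t i * c i + t i * d i =
      t i * ((a i + b i + c i + d i : ℕ) : ℝ) := by push_cast; ring
  have r4 : t i * ((a i + b i + c i + d i : ℕ) : ℝ) - t i * ((a i + c i : ℕ) : ℝ) =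
      t i * ((b i + d i : ℕ) : ℝ) := by push_cast; ring
  have r5 : t i * ((a i + b i + c i + d i : ℕ) : ℝ) - t i * ((a i + b i : ℕ) : ℝ) =
      t i * ((c i + d i : ℕ) : ℝ) := by push_cast; ring
  have r6 : t i * ((a i + b i : ℕ) : ℝ) - t i * a i = t i * b i := by push_cast; ring
  have r7 : t i * ((a i + c i : ℕ) : ℝ) - t i * a i = t i * c i := by push_cast; ring
  have r8 : t i * ((c i + d i : ℕ) : ℝ) - t i * ((a i + c i : ℕ) : ℝ) + t i * a i = t i * d i := by
    push_cast; ring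
  rw [r3, r1, r2, r4, r5, r6, r7, r8]
  field_simp
  ring

/-! ### First-order expansions -/

theorem tendsto_of_tendsto_scaled {ι : Type*} {L : Filter ι} {s u : ι → ℝ} {p v : ℝ}
    (hs : Tendsto s L atTop) (hu : Tendsto (fun i => s i * (u i - p)) L (𝓝 v)) :
    Tendsto u L (𝓝 p) := by
  have h := (hs.inv_tendsto_atTop.mul hu).add_const p
  rw [zero_mul, zero_add] at h
  refine h.congr' ?_
  filter_upwards [hs.eventually_gt_atTop 0] with i hi
  simp only [Pi.inv_apply]
  field_simp
  ring

/-- The chain rule for expansions `u i = p + v / s i + o (1 / s i)`. -/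
theorem tendsto_scaled_comp {ι : Type*} {L : Filter ι} {s u : ι → ℝ} {p v f' : ℝ} {f : ℝ → ℝ}
    (hs : Tendsto s L atTop) (hf : HasDerivAt f f' p)
    (hu : Tendsto (fun i => s i * (u i - p)) L (𝓝 v)) :
    Tendsto (fun i => s i * (f (u i) - f p)) L (𝓝 (f' * v)) := by
  have h0 : Tendsto (fun i => u i - p) L (𝓝 0) := by
    simpa using (tendsto_of_tendsto_scaled hs hu).sub_const p
  have := hf.hasFDerivAt.hasFDerivWithinAt.lim (s := Set.univ) h0 (by simp) hu
  simpa [mul_comm] using this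

/-- The first-order dependence of `mode` on its middle argument. -/
theorem tendsto_scaled_mode {ι : Type*} {L : Filter ι} {s k l n : ι → ℝ} {k₀ l₀ n₀ v : ℝ}
    (hs : Tendsto s L atTop) (hl : 0 < l₀) (hln : l₀ < n₀)
    (hk' : Tendsto (fun i => s i * (k i - k₀)) L (𝓝 0))
    (hl' : Tendsto (fun i => s i * (l i - l₀)) L (𝓝 v))
    (hn' : Tendsto (fun i => s i * (n i - n₀)) L (𝓝 0)) :
    Tendsto (fun i => s i * (mode (k i) (l i) (n i) - mode k₀ l₀ n₀)) L
      (𝓝 (Real.exp (-l₀) * (1 - Real.exp (-k₀)) / modeDen k₀ l₀ n₀ * v)) := by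
  have hexp : ∀ u, HasDerivAt (fun u => Real.exp (-u)) (-Real.exp (-u)) u := fun u => by
    simpa using (hasDerivAt_neg u).exp
  have ek := tendsto_scaled_comp hs (hexp k₀) hk'
  have el := tendsto_scaled_comp hs (hexp l₀) hl'
  have en := tendsto_scaled_comp hs (hexp n₀) hn'
  have el0 : Tendsto (fun i => Real.exp (-l i)) L (𝓝 (Real.exp (-l₀))) :=
    (Real.continuous_exp.tendsto _).comp (tendsto_of_tendsto_scaled hs hl').neg
  have hden : Tendsto (fun i => s i * (modeDen (k i) (l i) (n i) - modeDen k₀ l₀ n₀)) L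
      (𝓝 (-Real.exp (-l₀) * v * (1 - Real.exp (-k₀)))) := by
    have := ((ek.mul (el0.const_sub 1)).add (el.mul_const (1 - Real.exp (-k₀)))).sub en
    convert! this using 2
    · rw [modeDen, modeDen]
      ring
    · ring
  have hT := modeDen_pos k₀ hl hln
  have h1 := tendsto_scaled_comp hs (Real.hasDerivAt_log hT.ne') hden
  have h2 := tendsto_scaled_comp hs (hasDerivAt_log_one_sub_exp_neg (hl.trans hln)) hn'
  have := h2.sub h1
  convert! this using 2
  · rw [mode, mode]
    ring
  · field_simp
    ring

/-! ### Covariance matrices of Markov type -/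

theorem sum_fin_telescope (f : ℕ → ℝ) {M r : ℕ} (hM : M ≤ r) :
    ∑ k : Fin r, (if M ≤ (k : ℕ) then f k - f (k + 1) else 0) = f M - f r := by
  rw [Fin.sum_univ_eq_sum_range (fun k => if M ≤ k then f k - f (k + 1) else 0) r]
  induction r, hM using Nat.le_induction with
  | base =>
    rw [sub_self]
    exact Finset.sum_eq_zero fun k hk => if_neg (by simpa using hk)
  | succ r hr ih =>
    rw [Finset.sum_range_succ, ih, if_pos hr]
    ring

section Markov

variable (r : ℕ) (a c : ℕ → ℝ)

/-- The covariance matrix `C i j = a i * a j * c (max i j)` of a Gaussian Markov chain run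
backwards in the index. -/
def markovCov : Matrix (Fin r) (Fin r) ℝ :=
  Matrix.of fun i j => a i * a j * c (max (i : ℕ) j)

/-- The unitriangular matrix that expresses the chain through its independent innovations. -/
noncomputable def markovFactor : Matrix (Fin r) (Fin r) ℝ :=
  Matrix.of fun i j => if i ≤ j then a i / a j else 0

/-- The variance of the innovation at `i`. -/
def innovVar (i : ℕ) : ℝ := a i ^ 2 * (c i - c (i + 1))

variable {r a c}

theorem markovCov_eq (ha : ∀ i, a i ≠ 0) (hc : c r = 0) :
    markovCov r a c = markovFactor r a * Matrix.diagonal (fun i : Fin r => innovVar a c i) *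
      (markovFactor r a).transpose := by
  ext i j
  rw [Matrix.mul_apply]
  simp only [Matrix.mul_diagonal, Matrix.transpose_apply, markovCov, markovFactor, Matrix.of_apply]
  have h := sum_fin_telescope c (M := max (i : ℕ) j) (r := r) (by omega)
  rw [hc, sub_zero] at h
  rw [← h, Finset.mul_sum]
  refine Finset.sum_congr rfl fun k _ => ?_
  have := ha i; have := ha j; have := ha k
  simp only [Fin.le_def, max_le_iff]
  by_cases h1 : (i : ℕ) ≤ k <;> by_cases h2 : (j : ℕ) ≤ k <;> simp only [h1, h2, and_self,
    and_false, false_and, if_true, if_false, mul_zero, zero_mul]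
  rw [innovVar]
  field_simp

theorem det_markovFactor (ha : ∀ i, a i ≠ 0) : (markovFactor r a).det = 1 := by
  rw [Matrix.det_of_isUpperTriangular]
  · exact Finset.prod_eq_one fun i _ => by simp [markovFactor, ha i]
  · intro i j hij
    simp only [markovFactor, Matrix.of_apply]
    exact if_neg (not_le.2 hij)

theorem det_markovCov (ha : ∀ i, a i ≠ 0) (hc : c r = 0) :
    (markovCov r a c).det = ∏ i ∈ Finset.range r, innovVar a c i := by
  rw [markovCov_eq ha hc, Matrix.det_mul, Matrix.det_mul, Matrix.det_transpose,
    det_markovFactor ha, Matrix.det_diagonal, one_mul, mul_one, Finset.prod_range]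

theorem markovFactor_mulVec (ha : ∀ i, a i ≠ 0) {α : ℕ → ℝ} (hα : α r = 0) :
    (markovFactor r a).mulVec (fun i : Fin r => α i - a i / a (i + 1) * α (i + 1)) =
      fun i : Fin r => α i := by
  ext i
  have h := sum_fin_telescope (fun k => α k / a k) (M := i) (r := r) i.is_lt.le
  rw [hα, zero_div, sub_zero, eq_div_iff (ha i), Finset.sum_mul] at h
  rw [← h, Matrix.mulVec, dotProduct]
  refine Finset.sum_congr rfl fun k _ => ?_
  have h1 := ha k; have h2 := ha (k + 1)
  simp only [markovFactor, Matrix.of_apply, Fin.le_def]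
  split_ifs
  · field_simp
  · simp

/-- The quadratic form of the inverse covariance is the sum of the normalized squares of the
innovations. -/
theorem dotProduct_inv_markovCov (ha : ∀ i, a i ≠ 0) (hc : c r = 0)
    (hv : ∀ i < r, innovVar a c i ≠ 0) {α : ℕ → ℝ} (hα : α r = 0) :
    (fun i : Fin r => α i) ⬝ᵥ ((markovCov r a c)⁻¹).mulVec (fun i : Fin r => α i) =
      ∑ i ∈ Finset.range r, (α i - a i / a (i + 1) * α (i + 1)) ^ 2 / innovVar a c i := by
  set W := markovFactor r a with hW
  set w : Fin r → ℝ := fun i => α i - a i / a (i + 1) * α (i + 1) with hw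
  set v : Fin r → ℝ := fun i => innovVar a c i with hvdef
  have hdet : IsUnit W.det := by rw [hW, det_markovFactor ha]; exact isUnit_one
  have hWw : W.mulVec w = fun i : Fin r => α i := markovFactor_mulVec ha hα
  have hD : (Matrix.diagonal v)⁻¹ = Matrix.diagonal (fun i => (v i)⁻¹) := by
    apply Matrix.inv_eq_right_inv
    rw [Matrix.diagonal_mul_diagonal, ← Matrix.diagonal_one]
    congr 1
    ext i
    exact mul_inv_cancel₀ (hv i i.is_lt)
  have h1 : ((markovCov r a c)⁻¹).mulVec (W.mulVec w) =
      (W.transpose⁻¹).mulVec ((Matrix.diagonal (fun i => (v i)⁻¹)).mulVec w) := by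
    rw [markovCov_eq ha hc, Matrix.mul_inv_rev, Matrix.mul_inv_rev, hD, Matrix.mulVec_mulVec,
      Matrix.mulVec_mulVec, Matrix.mul_assoc, Matrix.mul_assoc, Matrix.nonsing_inv_mul _ hdet,
      Matrix.mul_one]
  have hdet' : IsUnit W.transpose.det := by rwa [Matrix.det_transpose]
  rw [← hWw, h1, dotProduct_comm, Matrix.dotProduct_mulVec, ← Matrix.mulVec_transpose,
    Matrix.mulVec_mulVec, Matrix.mul_nonsing_inv _ hdet', Matrix.one_mulVec, dotProduct,
    Finset.sum_range]
  refine Finset.sum_congr rfl fun i _ => ?_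
  rw [Matrix.mulVec_diagonal]
  simp only [hw, hvdef]
  ring

end Markov

/-! ### The limit shape along a vertical line -/

section shape

variable {k k' l n : ℝ}

/-- Consistency of the conditional maximizers: conditioning on the typical value at `k'` does not
change the typical value at `k`. -/
theorem modeDen_mode (hl : 0 < l) (hln : l < n) :
    modeDen k (mode k' l n) k' =
      (1 - Real.exp (-k')) * modeDen k l n / (1 - Real.exp (-n)) := by
  have := (one_sub_exp_neg_pos (hl.trans hln)).ne'
  rw [modeDen, exp_neg_mode hl hln, modeDen, modeDen]
  field_simp
  ring

theorem mode_mode (hk' : 0 < k') (hl : 0 < l) (hln : l < n) :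
    mode k (mode k' l n) k' = mode k l n := by
  have h1 := one_sub_exp_neg_pos hk'
  have h2 := one_sub_exp_neg_pos (hl.trans hln)
  have h3 := modeDen_pos k hl hln
  rw [mode, modeDen_mode hl hln, Real.log_div (by positivity) h2.ne',
    Real.log_mul h1.ne' h3.ne', mode]
  ring

/-- All values lie below `n`, so the height there is `l`. -/
theorem mode_self (hl : 0 < l) (hln : l < n) : mode n l n = l := by
  have h2 := one_sub_exp_neg_pos (hl.trans hln)
  have : modeDen n l n = Real.exp (-l) * (1 - Real.exp (-n)) := by
    rw [modeDen]
    ring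
  rw [mode, this, Real.log_mul (Real.exp_pos _).ne' h2.ne', Real.log_exp]
  ring

/-- The curvature of the transition from `k'` to `k`. -/
theorem transition_curvature (hk : 0 < k) (hkk' : k < k') (hl : 0 < l) (hln : l < n) :
    (1 - Real.exp (-k')) / ((1 - Real.exp (-(k - mode k l n))) *
      (1 - Real.exp (-(mode k' l n - mode k l n)))) =
    (1 - Real.exp (-k')) * modeDen k l n ^ 2 / ((Real.exp (-l) - Real.exp (-n)) *
      (1 - Real.exp (-k)) * ((Real.exp (-k) - Real.exp (-k')) * (1 - Real.exp (-l)))) := by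
  have hk' : 0 < k' := hk.trans hkk'
  have h1 := one_sub_exp_neg_pos hk
  have h2 := one_sub_exp_neg_pos hk'
  have h3 := one_sub_exp_neg_pos hl
  have h4 := one_sub_exp_neg_pos (hl.trans hln)
  have h5 : 0 < Real.exp (-l) - Real.exp (-n) := sub_pos.2 (by gcongr)
  have h6 : 0 < Real.exp (-k) - Real.exp (-k') := sub_pos.2 (by gcongr)
  have hT := modeDen_pos k hl hln
  have hm' := mode_pos hk' hl hln
  have hm'' : mode k' l n < k' := sub_pos.1 (mode_lt_left hk' hl hln)
  have key := one_sub_exp_neg_right_sub_mode (k := k) hm' hm''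
  rw [mode_mode hk' hl hln, modeDen_mode hl hln, one_sub_exp_neg_mode hl hln] at key
  rw [key, one_sub_exp_neg_left_sub_mode hl hln]
  field_simp

/-- The regression coefficient of the transition from `k'` to `k`. -/
theorem transition_slope (hk' : 0 < k') (hl : 0 < l) (hln : l < n) :
    Real.exp (-mode k' l n) * (1 - Real.exp (-k)) / modeDen k (mode k' l n) k' =
      modeDen k' l n * (1 - Real.exp (-k)) / ((1 - Real.exp (-k')) * modeDen k l n) := by
  have h2 := one_sub_exp_neg_pos hk'
  have h4 := one_sub_exp_neg_pos (hl.trans hln)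
  have hT := modeDen_pos k hl hln
  rw [modeDen_mode hl hln, exp_neg_mode hl hln]
  field_simp

theorem mul_h_eq_mode {β : ℝ} (hβ : 0 < β) (x y : ℝ) :
    β * h β x y = mode (β * y) (β * x) β := by
  rw [h, mode, modeDen, ← mul_assoc, mul_one_div_cancel hβ.ne', one_mul, ← Real.exp_add]
  congr 3
  rw [show -β * (x + y) = -(β * y) + -(β * x) by ring, show -β * x = -(β * x) by ring,
    show -β * y = -(β * y) by ring]
  ring

end shape

/-! ### The covariance matrix -/

section cov

variable {β x : ℝ}

/-- The factor `a` in the form `a i * a j * c (max i j)` of the matrix `cov`. -/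
noncomputable def covScale (β x y : ℝ) : ℝ :=
  (1 - Real.exp (-(β * y))) / modeDen (β * y) (β * x) β

/-- The factor `c` in the form `a i * a j * c (max i j)` of the matrix `cov`: a positive multiple of
`-1 / z β y` for `0 < y < 1`, which vanishes at `y = 1`. -/
noncomputable def covRatio (β x y : ℝ) : ℝ :=
  (Real.exp (-(β * x)) - Real.exp (-β)) * (1 - Real.exp (-(β * x))) / (1 - Real.exp (-β)) / β *
    ((Real.exp (-(β * y)) - Real.exp (-β)) / (1 - Real.exp (-(β * y))))

theorem sigma_sq (hβ : 0 < β) (hx : x ∈ Set.Ioo (0 : ℝ) 1) {y : ℝ} (hy : y ∈ Set.Ioo (0 : ℝ) 1) :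
    sigma β x y ^ 2 = 1 / (covScale β x y ^ 2 * covRatio β x y) := by
  have hl : 0 < β * x := mul_pos hβ hx.1
  have hln : β * x < β := by nlinarith [hx.2]
  have hk : 0 < β * y := mul_pos hβ hy.1
  have hkn : β * y < β := by nlinarith [hy.2]
  have h1 := one_sub_exp_neg_pos hk
  have h2 := one_sub_exp_neg_pos hl
  have h3 := one_sub_exp_neg_pos hβ
  have h5 : 0 < Real.exp (-(β * x)) - Real.exp (-β) := sub_pos.2 (by gcongr)
  have h6 : 0 < Real.exp (-(β * y)) - Real.exp (-β) := sub_pos.2 (by gcongr)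
  have hT := modeDen_pos (β * y) hl hln
  rw [sigma, show -β * (x - h β x y) = -(β * x - mode (β * y) (β * x) β) by
      rw [← mul_h_eq_mode hβ]; ring,
    show -β * (y - h β x y) = -(β * y - mode (β * y) (β * x) β) by
      rw [← mul_h_eq_mode hβ]; ring,
    one_sub_exp_neg_right_sub_mode hl hln, one_sub_exp_neg_left_sub_mode hl hln,
    Real.sq_sqrt (by positivity), covScale, covRatio]
  field_simp

theorem covScale_pos (hβ : 0 < β) (hx : x ∈ Set.Ioo (0 : ℝ) 1) {y : ℝ} (hy : 0 < y) :
    0 < covScale β x y := by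
  have hl : 0 < β * x := mul_pos hβ hx.1
  have hln : β * x < β := by nlinarith [hx.2]
  have := modeDen_pos (β * y) hl hln
  have := one_sub_exp_neg_pos (mul_pos hβ hy)
  unfold covScale
  positivity

theorem covRatio_pos (hβ : 0 < β) (hx : x ∈ Set.Ioo (0 : ℝ) 1) {y : ℝ}
    (hy : y ∈ Set.Ioo (0 : ℝ) 1) : 0 < covRatio β x y := by
  have hl : 0 < β * x := mul_pos hβ hx.1
  have hln : β * x < β := by nlinarith [hx.2]
  have hk : 0 < β * y := mul_pos hβ hy.1
  have hkn : β * y < β := by nlinarith [hy.2]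
  have h1 := one_sub_exp_neg_pos hk
  have h2 := one_sub_exp_neg_pos hl
  have h3 := one_sub_exp_neg_pos hβ
  have h5 : 0 < Real.exp (-(β * x)) - Real.exp (-β) := sub_pos.2 (by gcongr)
  have h6 : 0 < Real.exp (-(β * y)) - Real.exp (-β) := sub_pos.2 (by gcongr)
  unfold covRatio
  positivity

theorem z_div_z (hβ : 0 < β) (hx : x ∈ Set.Ioo (0 : ℝ) 1) {y y' : ℝ}
    (hy : y ∈ Set.Ioo (0 : ℝ) 1) (hy' : y' ∈ Set.Ioo (0 : ℝ) 1) :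
    z β y / z β y' = covRatio β x y' / covRatio β x y := by
  have hl : 0 < β * x := mul_pos hβ hx.1
  have hln : β * x < β := by nlinarith [hx.2]
  have h2 := one_sub_exp_neg_pos hl
  have h3 := one_sub_exp_neg_pos hβ
  have h5 : 0 < Real.exp (-(β * x)) - Real.exp (-β) := sub_pos.2 (by gcongr)
  have hz : ∀ {y : ℝ}, y ∈ Set.Ioo (0 : ℝ) 1 → z β y =
      -(Real.exp (-β) * ((1 - Real.exp (-(β * y))) / (Real.exp (-(β * y)) - Real.exp (-β)))) := by
    intro y hy
    have hkn : β * y < β := by nlinarith [hy.2]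
    have h6 : 0 < Real.exp (-(β * y)) - Real.exp (-β) := sub_pos.2 (by gcongr)
    have h7 : 0 < 1 - Real.exp (-β) / Real.exp (-(β * y)) := by
      rw [← Real.exp_sub, show -β - -(β * y) = -(β - β * y) by ring]
      exact one_sub_exp_neg_pos (by linarith)
    rw [z, show -β * (1 - y) = -β - -(β * y) by ring, Real.exp_sub]
    rw [div_eq_iff h7.ne']
    field_simp
    ring
  have hk : 0 < β * y := mul_pos hβ hy.1
  have hkn : β * y < β := by nlinarith [hy.2]
  have hk' : 0 < β * y' := mul_pos hβ hy'.1
  have hkn' : β * y' < β := by nlinarith [hy'.2]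
  have h1 := one_sub_exp_neg_pos hk
  have h1' := one_sub_exp_neg_pos hk'
  have h6 : 0 < Real.exp (-(β * y)) - Real.exp (-β) := sub_pos.2 (by gcongr)
  have h6' : 0 < Real.exp (-(β * y')) - Real.exp (-β) := sub_pos.2 (by gcongr)
  rw [hz hy, hz hy', covRatio, covRatio]
  field_simp

theorem cov_eq_markovCov (hβ : 0 < β) (hx : x ∈ Set.Ioo (0 : ℝ) 1) {r : ℕ} {y : Fin r → ℝ}
    (hy : ∀ i, y i ∈ Set.Ioo (0 : ℝ) 1) {y' : ℕ → ℝ} (hy' : ∀ i : Fin r, y' i = y i) :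
    cov β x y = markovCov r (fun i => covScale β x (y' i)) (fun i => covRatio β x (y' i)) := by
  ext i j
  rw [cov, markovCov, Matrix.of_apply, Matrix.of_apply]
  have hmax : y' (max (i : ℕ) j) = y (max i j) := by rw [← hy', Fin.coe_max]
  rw [hmax, hy', hy']
  have a1 := covScale_pos hβ hx (hy i).1
  have a2 := covScale_pos hβ hx (hy j).1
  have c1 := covRatio_pos hβ hx (hy i)
  have c2 := covRatio_pos hβ hx (hy j)
  split_ifs with hij
  · subst hij
    rw [max_self, sigma_sq hβ hx (hy i), one_div_one_div, sq]
  · rw [Real.sqrt_eq_iff_mul_self_eq_of_pos (by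
      have := covRatio_pos hβ hx (hy (max i j))
      positivity), mul_assoc (z β _), ← div_div, z_div_z hβ hx (hy _) (hy _),
      sigma_sq hβ hx (hy i), sigma_sq hβ hx (hy j)]
    rcases le_total i j with h | h
    · rw [max_eq_right h, min_eq_left h]
      field_simp
    · rw [max_eq_left h, min_eq_right h]
      field_simp

theorem covRatio_one (β x : ℝ) : covRatio β x 1 = 0 := by
  simp [covRatio]

/-- The variance of an innovation is the inverse of `β` times the curvature of the transition. -/
theorem innovation_eq (hβ : 0 < β) (hx : x ∈ Set.Ioo (0 : ℝ) 1) {y y' : ℝ} (hy : 0 < y)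
    (hyy' : y < y') :
    covScale β x y ^ 2 * (covRatio β x y - covRatio β x y') =
      1 / (β * ((1 - Real.exp (-(β * y'))) /
        ((1 - Real.exp (-(β * y - mode (β * y) (β * x) β))) *
      (1 - Real.exp (-(mode (β * y') (β * x) β - mode (β * y) (β * x) β)))))) := by
  have hl : 0 < β * x := mul_pos hβ hx.1
  have hln : β * x < β := by nlinarith [hx.2]
  have hk : 0 < β * y := mul_pos hβ hy
  have hkk' : β * y < β * y' := by gcongr
  have h1 := one_sub_exp_neg_pos hk
  have h1' := one_sub_exp_neg_pos (hk.trans hkk')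
  have h2 := one_sub_exp_neg_pos hl
  have h3 := one_sub_exp_neg_pos hβ
  have h5 : 0 < Real.exp (-(β * x)) - Real.exp (-β) := sub_pos.2 (by gcongr)
  have h6 : 0 < Real.exp (-(β * y)) - Real.exp (-(β * y')) := sub_pos.2 (by gcongr)
  have hT := modeDen_pos (β * y) hl hln
  rw [transition_curvature hk hkk' hl hln, covScale, covRatio, covRatio]
  field_simp
  ring

/-- The regression coefficient of a transition is a ratio of scale factors. -/
theorem covScale_div (hβ : 0 < β) (hx : x ∈ Set.Ioo (0 : ℝ) 1) {y y' : ℝ} (hy' : 0 < y') :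
    Real.exp (-mode (β * y') (β * x) β) * (1 - Real.exp (-(β * y))) /
      modeDen (β * y) (mode (β * y') (β * x) β) (β * y') =
      covScale β x y / covScale β x y' := by
  have hl : 0 < β * x := mul_pos hβ hx.1
  have hln : β * x < β := by nlinarith [hx.2]
  rw [transition_slope (mul_pos hβ hy') hl hln, covScale, covScale]
  have h1' := one_sub_exp_neg_pos (mul_pos hβ hy')
  have hT := modeDen_pos (β * y) hl hln
  have hT' := modeDen_pos (β * y') hl hln
  field_simp

end cov

/-! ### The scaling `q = 1 - β / N` -/

theorem tendsto_sqrt_natCast : Tendsto (fun N : ℕ => √(N : ℝ)) atTop atTop :=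
  Real.tendsto_sqrt_atTop.comp tendsto_natCast_atTop_atTop

/-- With `t = -log (1 - β / N)`, the product `N t` is `β + O (1 / N)`. -/
theorem tendsto_sqrt_mul_log {β : ℝ} (hβ : 0 < β) :
    Tendsto (fun N : ℕ => √(N : ℝ) * (N * -Real.log (1 - β / N) - β)) atTop (𝓝 0) := by
  have hb : Tendsto (fun N : ℕ => 2 * β ^ 2 * (√(N : ℝ))⁻¹) atTop (𝓝 0) := by
    simpa using tendsto_sqrt_natCast.inv_tendsto_atTop.const_mul (2 * β ^ 2)
  have hev : ∀ᶠ N : ℕ in atTop, 2 * β < N :=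
    tendsto_natCast_atTop_atTop.eventually_gt_atTop (2 * β)
  refine squeeze_zero' ?_ ?_ hb
  · filter_upwards [hev] with N hN
    have hN0 : (0 : ℝ) < N := by linarith
    have h1 : β / N < 1 := by rw [div_lt_one hN0]; linarith
    have h2 := Real.log_le_sub_one_of_pos (show 0 < 1 - β / N by linarith)
    have h3 : N * (β / N) = β := by field_simp
    have : 0 ≤ N * -Real.log (1 - β / N) - β := by nlinarith
    positivity
  · filter_upwards [hev] with N hN
    have hN0 : (0 : ℝ) < N := by linarith
    have h1 : β / N < 1 / 2 := by rw [div_lt_iff₀ hN0]; linarith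
    have h0 : 0 < 1 - β / N := by linarith
    have h2 := Real.one_sub_inv_le_log_of_pos h0
    -- the tail of the geometric series is at most twice its first term, as `β / N < 1 / 2`
    have h4 : (1 - β / N)⁻¹ ≤ 1 + β / N + 2 * (β / N) ^ 2 := by
      rw [inv_le_iff_one_le_mul₀ h0]
      have : 0 < β / N := by positivity
      nlinarith [sq_nonneg (β / N), mul_pos this this]
    have h5 : N * (β / N + 2 * (β / N) ^ 2) - β = 2 * β ^ 2 / N := by field_simp; ring
    have h6 : N * -Real.log (1 - β / N) - β ≤ 2 * β ^ 2 / N := by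
      rw [← h5]
      gcongr
      linarith
    calc √(N : ℝ) * (N * -Real.log (1 - β / N) - β) ≤ √(N : ℝ) * (2 * β ^ 2 / N) := by gcongr
      _ = 2 * β ^ 2 * (√(N : ℝ))⁻¹ := by
        have hs := Real.sqrt_pos.2 hN0
        nth_rewrite 2 [← Real.sq_sqrt hN0.le]
        field_simp

theorem tendsto_mul_log {β : ℝ} (hβ : 0 < β) :
    Tendsto (fun N : ℕ => N * -Real.log (1 - β / N)) atTop (𝓝 β) :=
  tendsto_of_tendsto_scaled tendsto_sqrt_natCast (tendsto_sqrt_mul_log hβ)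

theorem eventually_neg_log_pos {β : ℝ} (hβ : 0 < β) :
    ∀ᶠ N : ℕ in atTop, 0 < -Real.log (1 - β / N) := by
  filter_upwards [(tendsto_mul_log hβ).eventually_const_lt hβ] with N hN
  exact pos_of_mul_pos_right hN (Nat.cast_nonneg N)

theorem tendsto_neg_log {β : ℝ} (hβ : 0 < β) :
    Tendsto (fun N : ℕ => -Real.log (1 - β / N)) atTop (𝓝 0) := by
  have := (tendsto_mul_log hβ).mul (tendsto_inv_atTop_nhds_zero_nat (𝕜 := ℝ))
  rw [mul_zero] at this
  refine this.congr' ?_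
  filter_upwards [eventually_gt_atTop 0] with N hN
  have : (N : ℝ) ≠ 0 := by positivity
  field_simp

/-- Integer sequences `p N + α √N + O (1)` in the scale `t = -log (1 - β / N)`. -/
theorem tendsto_sqrt_mul_natCast {β : ℝ} (hβ : 0 < β) {n : ℕ → ℕ} {p α : ℝ}
    (hn : ∀ᶠ N : ℕ in atTop, |(n N : ℝ) - (p * N + α * √(N : ℝ))| ≤ 1) :
    Tendsto (fun N : ℕ => √(N : ℝ) * (-Real.log (1 - β / N) * n N - β * p)) atTop
      (𝓝 (β * α)) := by
  have h0 : Tendsto (fun N : ℕ => ((n N : ℝ) - (p * N + α * √(N : ℝ))) / √(N : ℝ)) atTop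
      (𝓝 0) := by
    refine squeeze_zero_norm' ?_ tendsto_sqrt_natCast.inv_tendsto_atTop
    filter_upwards [hn] with N hN
    rw [norm_div, Real.norm_eq_abs, Real.norm_of_nonneg (Real.sqrt_nonneg _), Pi.inv_apply,
      ← one_div]
    gcongr
  have h1 := (((tendsto_sqrt_mul_log hβ).mul_const p).add ((tendsto_mul_log hβ).mul_const α)).add
    ((tendsto_mul_log hβ).mul h0)
  rw [zero_mul, zero_add, mul_zero, add_zero] at h1
  refine h1.congr' ?_
  filter_upwards [eventually_gt_atTop 0] with N hN
  have hN0 : (0 : ℝ) < N := by positivity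
  have hs := Real.sqrt_pos.2 hN0
  have hsq := Real.sq_sqrt hN0.le
  generalize -Real.log (1 - β / N) = τ
  generalize √(N : ℝ) = s at *
  rw [← hsq]
  field_simp
  ring

/-- This makes the natural-number floor of `p N + α √N` agree with the integer one. -/
theorem eventually_nonneg_linear {p : ℝ} (hp : 0 < p) (α : ℝ) :
    ∀ᶠ N : ℕ in atTop, 0 ≤ p * N + α * √(N : ℝ) := by
  filter_upwards [(tendsto_sqrt_natCast.const_mul_atTop hp).eventually_ge_atTop (-α)] with N hN
  have h1 := Real.sqrt_nonneg (N : ℝ)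
  have h2 := Real.mul_self_sqrt (Nat.cast_nonneg (α := ℝ) N)
  nlinarith

theorem eventually_abs_floor_sub_le {p : ℝ} (hp : 0 < p) (α : ℝ) :
    ∀ᶠ N : ℕ in atTop,
      |((⌊p * (N : ℝ) + α * √(N : ℝ)⌋₊ : ℕ) : ℝ) - (p * N + α * √(N : ℝ))| ≤ 1 := by
  filter_upwards [eventually_nonneg_linear hp α] with N hN
  have h1 := Nat.floor_le hN
  have h2 := Nat.lt_floor_add_one (p * (N : ℝ) + α * √(N : ℝ))
  rw [abs_le]
  constructor <;> linarith

theorem eventually_lt_of_scaled {t : ℕ → ℝ} {m n : ℕ → ℕ} {a b : ℝ} (ht : ∀ᶠ N in atTop, 0 < t N)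
    (hm : Tendsto (fun N => t N * m N) atTop (𝓝 a)) (hn : Tendsto (fun N => t N * n N) atTop (𝓝 b))
    (hab : a < b) : ∀ᶠ N in atTop, m N < n N := by
  filter_upwards [ht, hm.eventually_lt hn hab] with N h1 h2
  exact Nat.cast_lt.1 (lt_of_mul_lt_mul_left h2 h1.le)

section step

variable {β x y y' α α' : ℝ} {K m K' m' : ℕ → ℕ}

/-- The order relations between the values of the height function at two heights. -/
theorem eventually_order (hβ : 0 < β) (hx : x ∈ Set.Ioo (0 : ℝ) 1) (hy : 0 < y) (hyy' : y < y')
    (hK : Tendsto (fun N : ℕ => -Real.log (1 - β / N) * K N) atTop (𝓝 (β * y)))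
    (hm : Tendsto (fun N : ℕ => -Real.log (1 - β / N) * m N) atTop
      (𝓝 (mode (β * y) (β * x) β)))
    (hK' : Tendsto (fun N : ℕ => -Real.log (1 - β / N) * K' N) atTop (𝓝 (β * y')))
    (hm' : Tendsto (fun N : ℕ => -Real.log (1 - β / N) * m' N) atTop
      (𝓝 (mode (β * y') (β * x) β))) :
    ∀ᶠ N in atTop, m N < K N ∧ m N < m' N ∧ K N + m' N < K' N + m N := by
  have ht := eventually_neg_log_pos hβ
  have hl : 0 < β * x := mul_pos hβ hx.1
  have hln : β * x < β := by nlinarith [hx.2]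
  have hk : 0 < β * y := mul_pos hβ hy
  have hkk' : β * y < β * y' := by gcongr
  have hm0 := mode_pos (hk.trans hkk') hl hln
  have hmk := sub_pos.1 (mode_lt_left (hk.trans hkk') hl hln)
  have hC := mode_lt_right hkk' hm0 hmk
  have hD := rest_mode_pos hkk' hm0 hmk
  rw [mode_mode (hk.trans hkk') hl hln] at hC hD
  refine (eventually_lt_of_scaled ht hm hK (sub_pos.1 (mode_lt_left hk hl hln))).and
    ((eventually_lt_of_scaled ht hm hm' (sub_pos.1 hC)).and ?_)
  refine eventually_lt_of_scaled ht (m := fun N => K N + m' N) (n := fun N => K' N + m N) ?_ ?_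
    (show β * y + mode (β * y') (β * x) β < β * y' + mode (β * y) (β * x) β by linarith)
  · simpa only [Nat.cast_add, mul_add] using hK.add hm'
  · simpa only [Nat.cast_add, mul_add] using hK'.add hm

/-- The limit of one transition probability of the chain of heights, at distance of order `√N` from
the limit shape. -/
theorem tendsto_sqrt_mul_transition (hβ : 0 < β) (hx : x ∈ Set.Ioo (0 : ℝ) 1) (hy : 0 < y)
    (hyy' : y < y')
    (hK : Tendsto (fun N : ℕ => √(N : ℝ) * (-Real.log (1 - β / N) * K N - β * y)) atTop (𝓝 0))
    (hm : Tendsto (fun N : ℕ => √(N : ℝ) * (-Real.log (1 - β / N) * m N -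
      mode (β * y) (β * x) β)) atTop (𝓝 (β * α)))
    (hK' : Tendsto (fun N : ℕ => √(N : ℝ) * (-Real.log (1 - β / N) * K' N - β * y')) atTop (𝓝 0))
    (hm' : Tendsto (fun N : ℕ => √(N : ℝ) * (-Real.log (1 - β / N) * m' N -
      mode (β * y') (β * x) β)) atTop (𝓝 (β * α'))) :
    Tendsto (fun N : ℕ => √(2 * Real.pi * N) * transition (1 - β / N) (m N) (K N - m N)
      (m' N - m N) (K' N - m' N - (K N - m N))) atTop
      (𝓝 (√(1 / (covScale β x y ^ 2 * (covRatio β x y - covRatio β x y'))) *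
        Real.exp (-((α - covScale β x y / covScale β x y' * α') ^ 2 /
          (covScale β x y ^ 2 * (covRatio β x y - covRatio β x y'))) / 2))) := by
  set t : ℕ → ℝ := fun N => -Real.log (1 - β / N) with ht_def
  have ht0 : ∀ᶠ N in atTop, 0 < t N := eventually_neg_log_pos hβ
  have ht : Tendsto t atTop (𝓝 0) := tendsto_neg_log hβ
  have hNt : Tendsto (fun N : ℕ => N * t N) atTop (𝓝 β) := tendsto_mul_log hβ
  have hs := tendsto_sqrt_natCast
  have lK := tendsto_of_tendsto_scaled hs hK
  have lm := tendsto_of_tendsto_scaled hs hm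
  have lK' := tendsto_of_tendsto_scaled hs hK'
  have lm' := tendsto_of_tendsto_scaled hs hm'
  have hord := eventually_order hβ hx hy hyy' lK lm lK' lm'
  have hl : 0 < β * x := mul_pos hβ hx.1
  have hln : β * x < β := by nlinarith [hx.2]
  have hk : 0 < β * y := mul_pos hβ hy
  have hkk' : β * y < β * y' := by gcongr
  have hm0 := mode_pos (hk.trans hkk') hl hln
  have hmk := sub_pos.1 (mode_lt_left (hk.trans hkk') hl hln)
  have hA := mode_pos hk hl hln
  have hB := mode_lt_left hk hl hln
  have hC := mode_lt_right hkk' hm0 hmk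
  have hD := rest_mode_pos hkk' hm0 hmk
  have hmm := mode_mode (k := β * y) (hk.trans hkk') hl hln
  rw [hmm] at hC hD
  have hmode := tendsto_scaled_mode hs hm0 hmk hK hm' hK'
  rw [hmm, covScale_div hβ hx (hy.trans hyy')] at hmode
  have hV := innovation_eq hβ hx hy hyy'
  set H := mode (β * y) (β * x) β with hH
  set H' := mode (β * y') (β * x) β with hH'
  set ρ := covScale β x y / covScale β x y' with hρ
  set v := covScale β x y ^ 2 * (covRatio β x y - covRatio β x y') with hv
  set V := (1 - Real.exp (-(β * y'))) /
    ((1 - Real.exp (-(β * y - H))) * (1 - Real.exp (-(H' - H)))) with hVdef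
  have hVpos : 0 < V := by
    have := one_sub_exp_neg_pos hB
    have := one_sub_exp_neg_pos hC
    have := one_sub_exp_neg_pos (hk.trans hkk')
    positivity
  have cb : ∀ᶠ N in atTop, ((K N - m N : ℕ) : ℝ) = (K N : ℝ) - m N := by
    filter_upwards [hord] with N hN
    rw [Nat.cast_sub hN.1.le]
  have cc : ∀ᶠ N in atTop, ((m' N - m N : ℕ) : ℝ) = (m' N : ℝ) - m N := by
    filter_upwards [hord] with N hN
    rw [Nat.cast_sub hN.2.1.le]
  have cd : ∀ᶠ N in atTop, ((K' N - m' N - (K N - m N) : ℕ) : ℝ) =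
      (K' N : ℝ) - m' N - (K N - m N) := by
    filter_upwards [hord] with N hN
    rw [Nat.cast_sub (by omega), Nat.cast_sub (by omega), Nat.cast_sub hN.1.le]
  have hδ : Tendsto (fun N => (t N * m N - mode (t N * m N + t N * (K N - m N : ℕ))
      (t N * m N + t N * (m' N - m N : ℕ)) (t N * m N + t N * (K N - m N : ℕ) +
      t N * (m' N - m N : ℕ) + t N * (K' N - m' N - (K N - m N) : ℕ))) / √(t N)) atTop
      (𝓝 (β * (α - ρ * α') / √β)) := by
    have h1 := (hm.sub hmode).div ((Real.continuous_sqrt.tendsto β).comp hNt)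
      (Real.sqrt_pos.2 hβ).ne'
    have h2 : β * (α - ρ * α') / √β = (β * α - ρ * (β * α')) / √β := by ring
    rw [h2]
    refine h1.congr' ?_
    filter_upwards [cb, cc, cd, ht0, eventually_gt_atTop 0] with N e1 e2 e3 e4 e5
    have hN : (0 : ℝ) < N := Nat.cast_pos.2 e5
    rw [e1, e2, e3, show t N * m N + t N * ((K N : ℝ) - m N) = t N * K N by ring,
      show t N * m N + t N * ((m' N : ℝ) - m N) = t N * m' N by ring,
      show t N * K N + t N * ((m' N : ℝ) - m N) + t N * ((K' N : ℝ) - m' N - (K N - m N)) =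
        t N * K' N by ring]
    simp only [Pi.div_apply, Function.comp_apply]
    rw [Real.sqrt_mul hN.le, show -Real.log (1 - β / N) = t N from rfl]
    have := Real.sqrt_pos.2 hN
    have := Real.sqrt_pos.2 e4
    field_simp
    ring
  have key := tendsto_transition ht0 ht hA hB hC hD lm
    ((lK.sub lm).congr' (by filter_upwards [cb] with N e; rw [e]; ring))
    ((lm'.sub lm).congr' (by filter_upwards [cc] with N e; rw [e]; ring))
    ((((lK'.sub lK).sub lm').add lm).congr' (by filter_upwards [cd] with N e; rw [e]; ring)) hδ
  rw [show H + (β * y - H) + (H' - H) + (β * y' - β * y - H' + H) = β * y' by ring, ← hVdef] at key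
  have hall := ((Real.continuous_sqrt.tendsto _).comp (hNt.const_mul (2 * Real.pi))).mul key
  have hlim : √(1 / v) * Real.exp (-((α - ρ * α') ^ 2 / v) / 2) =
      √(2 * Real.pi * β) * (√(V / (2 * Real.pi)) *
        Real.exp (-V * (β * (α - ρ * α') / √β) ^ 2 / 2)) := by
    rw [← mul_assoc, ← Real.sqrt_mul (by positivity), hV, div_pow, Real.sq_sqrt hβ.le]
    congr 2
    · field_simp
    · field_simp
  rw [hlim]
  refine hall.congr' ?_
  filter_upwards [ht0, eventually_gt_atTop 0,
    tendsto_natCast_atTop_atTop.eventually_gt_atTop β] with N e1 e2 e3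
  have hN : (0 : ℝ) < N := Nat.cast_pos.2 e2
  have hq : Real.exp (-t N) = 1 - β / N := by
    rw [ht_def]
    simp only [neg_neg]
    exact Real.exp_log (by rw [sub_pos, div_lt_one hN]; exact e3)
  simp only [Function.comp_apply]
  rw [hq, ← mul_assoc (2 * Real.pi), Real.sqrt_mul (by positivity)]
  have := Real.sqrt_pos.2 e1
  field_simp

end step

/-! ### The joint law of the heights -/

theorem innovVar_pos {β x : ℝ} (hβ : 0 < β) (hx : x ∈ Set.Ioo (0 : ℝ) 1) {y y' : ℝ} (hy : 0 < y)
    (hyy' : y < y') : 0 < covScale β x y ^ 2 * (covRatio β x y - covRatio β x y') := by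
  have hl : 0 < β * x := mul_pos hβ hx.1
  have hln : β * x < β := by nlinarith [hx.2]
  have hk : 0 < β * y := mul_pos hβ hy
  have hkk' : β * y < β * y' := by gcongr
  have hm0 := mode_pos (hk.trans hkk') hl hln
  have hC := mode_lt_right hkk' hm0 (sub_pos.1 (mode_lt_left (hk.trans hkk') hl hln))
  rw [mode_mode (hk.trans hkk') hl hln] at hC
  rw [innovation_eq hβ hx hy hyy']
  have := one_sub_exp_neg_pos (mode_lt_left hk hl hln)
  have := one_sub_exp_neg_pos hC
  have := one_sub_exp_neg_pos (hk.trans hkk')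
  positivity

end Mallows

theorem theorem4p8 (r : ℕ) (β x : ℝ) (y α : Fin r → ℝ)
    (hβ : 0 < β) (hx : x ∈ Set.Ioo (0 : ℝ) 1)
    (hy : ∀ i, y i ∈ Set.Ioo (0 : ℝ) 1) (hy_mono : StrictMono y) :
    0 < (Mallows.cov β x y).det ∧
    Tendsto
      (fun N : ℕ =>
        Real.sqrt (2 * Real.pi * (N : ℝ)) ^ r * Real.sqrt (Mallows.cov β x y).det *
          Mallows.prob N (1 - β / (N : ℝ))
            {w | ∀ i : Fin r,
              (Mallows.height ⌊x * (N : ℝ)⌋₊ ⌊y i * (N : ℝ)⌋₊ w : ℤ) =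
                ⌊Mallows.h β x (y i) * (N : ℝ) + α i * Real.sqrt (N : ℝ)⌋})
      atTop
      (𝓝 (Real.exp (-(α ⬝ᵥ Matrix.mulVec (Mallows.cov β x y)⁻¹ α) / 2))) := by
  -- the chain of heights is continued by its deterministic value at `y = 1`
  set Y : ℕ → ℝ := fun i => if hi : i < r then y ⟨i, hi⟩ else 1 with hY
  set A : ℕ → ℝ := fun i => if hi : i < r then α ⟨i, hi⟩ else 0 with hA
  have Yfin : ∀ i : Fin r, Y i = y i := fun i => by simp [hY]
  have Afin : ∀ i : Fin r, A i = α i := fun i => by simp [hA]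
  have Ypos : ∀ i, 0 < Y i := fun i => by
    simp only [hY]
    split_ifs
    · exact (hy _).1
    · exact one_pos
  have Yge : ∀ i, r ≤ i → Y i = 1 := fun i hi => by simp [hY, not_lt.2 hi]
  have Age : ∀ i, r ≤ i → A i = 0 := fun i hi => by simp [hA, not_lt.2 hi]
  have Ylt : ∀ i < r, Y i < Y (i + 1) := fun i hi => by
    by_cases h : i + 1 < r
    · simp only [hY, hi, h, dif_pos]
      exact hy_mono (Fin.mk_lt_mk.2 (Nat.lt_succ_self i))
    · simp only [hY, hi, h, dif_pos, dif_neg, not_false_eq_true]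
      exact (hy _).2
  have hl : 0 < β * x := mul_pos hβ hx.1
  have hln : β * x < β := by nlinarith [hx.2]
  have hpos : ∀ i, 0 < Mallows.h β x (Y i) := fun i => by
    have := Mallows.mode_pos (mul_pos hβ (Ypos i)) hl hln
    rw [← Mallows.mul_h_eq_mode hβ] at this
    exact pos_of_mul_pos_right this hβ.le
  have hone : Mallows.h β x 1 = x := by
    have h1 := Mallows.mul_h_eq_mode hβ x 1
    rw [mul_one, Mallows.mode_self hl hln] at h1
    exact mul_left_cancel₀ hβ.ne' h1
  set K : ℕ → ℕ → ℕ := fun N i => ⌊Y i * (N : ℝ)⌋₊ with hKdef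
  set m : ℕ → ℕ → ℕ := fun N i => ⌊Mallows.h β x (Y i) * (N : ℝ) + A i * √(N : ℝ)⌋₊ with hmdef
  have hK : ∀ i, Tendsto (fun N : ℕ => √(N : ℝ) * (-Real.log (1 - β / N) * K N i - β * Y i)) atTop
      (𝓝 0) := fun i => by
    have := Mallows.tendsto_sqrt_mul_natCast hβ (n := fun N => K N i) (p := Y i) (α := 0) (by
      simpa using Mallows.eventually_abs_floor_sub_le (Ypos i) 0)
    rwa [mul_zero] at this
  have hm : ∀ i, Tendsto (fun N : ℕ => √(N : ℝ) * (-Real.log (1 - β / N) * m N i -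
      Mallows.mode (β * Y i) (β * x) β)) atTop (𝓝 (β * A i)) := fun i => by
    rw [← Mallows.mul_h_eq_mode hβ]
    exact Mallows.tendsto_sqrt_mul_natCast hβ (Mallows.eventually_abs_floor_sub_le (hpos i) (A i))
  set a : ℕ → ℝ := fun i => Mallows.covScale β x (Y i) with ha_def
  set c : ℕ → ℝ := fun i => Mallows.covRatio β x (Y i) with hc_def
  have ha : ∀ i, a i ≠ 0 := fun i => (Mallows.covScale_pos hβ hx (Ypos i)).ne'
  have hc : c r = 0 := by rw [hc_def]; simp only [Yge r le_rfl, Mallows.covRatio_one]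
  have hcov : Mallows.cov β x y = Mallows.markovCov r a c := Mallows.cov_eq_markovCov hβ hx hy Yfin
  have hv : ∀ i < r, 0 < Mallows.innovVar a c i := fun i hi =>
    Mallows.innovVar_pos hβ hx (Ypos i) (Ylt i hi)
  have hdet : (Mallows.cov β x y).det = ∏ i ∈ Finset.range r, Mallows.innovVar a c i := by
    rw [hcov, Mallows.det_markovCov ha hc]
  have hdetpos : 0 < (Mallows.cov β x y).det := by
    rw [hdet]
    exact Finset.prod_pos fun i hi => hv i (Finset.mem_range.1 hi)
  refine ⟨hdetpos, ?_⟩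
  have hquad : α ⬝ᵥ Matrix.mulVec (Mallows.cov β x y)⁻¹ α =
      ∑ i ∈ Finset.range r, (A i - a i / a (i + 1) * A (i + 1)) ^ 2 / Mallows.innovVar a c i := by
    rw [← Mallows.dotProduct_inv_markovCov ha hc (fun i hi => (hv i hi).ne') (Age r le_rfl), ← hcov]
    simp only [Afin]
  -- the probability is eventually a product of transition probabilities
  have hprob : ∀ᶠ N : ℕ in atTop, Mallows.prob N (1 - β / (N : ℝ))
      {w | ∀ i : Fin r, (Mallows.height ⌊x * (N : ℝ)⌋₊ ⌊y i * (N : ℝ)⌋₊ w : ℤ) =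
        ⌊Mallows.h β x (y i) * (N : ℝ) + α i * Real.sqrt (N : ℝ)⌋} =
      ∏ i ∈ Finset.range r, Mallows.transition (1 - β / N) (m N i) (K N i - m N i)
        (m N (i + 1) - m N i) (K N (i + 1) - m N (i + 1) - (K N i - m N i)) := by
    have hord : ∀ᶠ N in atTop, ∀ i ∈ Finset.range r, m N i < K N i ∧ m N i < m N (i + 1) ∧
        K N i + m N (i + 1) < K N (i + 1) + m N i := by
      rw [Filter.eventually_all_finset]
      intro i hi
      have hs := Mallows.tendsto_sqrt_natCast
      exact Mallows.eventually_order hβ hx (Ypos i) (Ylt i (Finset.mem_range.1 hi))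
        (Mallows.tendsto_of_tendsto_scaled hs (hK i)) (Mallows.tendsto_of_tendsto_scaled hs (hm i))
        (Mallows.tendsto_of_tendsto_scaled hs (hK (i + 1)))
        (Mallows.tendsto_of_tendsto_scaled hs (hm (i + 1)))
    have hnn : ∀ᶠ N : ℕ in atTop, ∀ i ∈ Finset.range r,
        0 ≤ Mallows.h β x (Y i) * (N : ℝ) + A i * √(N : ℝ) := by
      rw [Filter.eventually_all_finset]
      exact fun i _ => Mallows.eventually_nonneg_linear (hpos i) (A i)
    filter_upwards [hord, hnn, tendsto_natCast_atTop_atTop.eventually_gt_atTop β,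
      eventually_gt_atTop 0] with N h1 h2 h3 h4
    have hN : (0 : ℝ) < N := Nat.cast_pos.2 h4
    have hKge : ∀ i, r ≤ i → K N i = N := fun i hi => by simp [hKdef, Yge i hi]
    have hmge : ∀ i, r ≤ i → m N i = ⌊x * (N : ℝ)⌋₊ := fun i hi => by
      simp [hmdef, Yge i hi, Age i hi, hone]
    have hxN : ⌊x * (N : ℝ)⌋₊ ≤ N :=
      Nat.floor_le_of_le (by nlinarith [hx.2])
    have hq : 0 < 1 - β / (N : ℝ) := by rw [sub_pos, div_lt_one hN]; exact h3
    have hset : {w : Equiv.Perm (Fin N) | ∀ i : Fin r,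
        (Mallows.height ⌊x * (N : ℝ)⌋₊ ⌊y i * (N : ℝ)⌋₊ w : ℤ) =
        ⌊Mallows.h β x (y i) * (N : ℝ) + α i * Real.sqrt (N : ℝ)⌋} =
        Mallows.heightEvent (K N) (m N) r N ⌊x * (N : ℝ)⌋₊ := by
      ext w
      simp only [Mallows.heightEvent, Set.mem_ofPred_eq]
      have hiff : ∀ i : Fin r, (Mallows.height ⌊x * (N : ℝ)⌋₊ ⌊y i * (N : ℝ)⌋₊ w : ℤ) =
          ⌊Mallows.h β x (y i) * (N : ℝ) + α i * Real.sqrt (N : ℝ)⌋ ↔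
          Mallows.height ⌊x * (N : ℝ)⌋₊ (K N i) w = m N i := fun i => by
        have := h2 i (Finset.mem_range.2 i.is_lt)
        simp only [hKdef, hmdef]
        rw [← Yfin i, ← Afin i, ← Int.natCast_floor_eq_floor this, Nat.cast_inj]
      exact ⟨fun h i hi => (hiff ⟨i, hi⟩).1 (h ⟨i, hi⟩), fun h i => (hiff i).2 (h i i.is_lt)⟩
    rw [hset]
    have hle : ∀ i, m N i ≤ K N i := fun i => by
      rcases lt_or_ge i r with hi | hi
      · exact (h1 i (Finset.mem_range.2 hi)).1.le
      · rw [hKge i hi, hmge i hi]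
        exact hxN
    refine Mallows.prob_heightEvent hq (monotone_nat_of_le_succ fun i => ?_)
      (monotone_nat_of_le_succ fun i => ?_) (monotone_nat_of_le_succ fun i => ?_) hle
      (hKge r le_rfl) (hmge r le_rfl)
    · rcases lt_or_ge i r with hi | hi
      · have := h1 i (Finset.mem_range.2 hi)
        omega
      · rw [hKge i hi, hKge (i + 1) (by omega)]
    · rcases lt_or_ge i r with hi | hi
      · exact (h1 i (Finset.mem_range.2 hi)).2.1.le
      · rw [hmge i hi, hmge (i + 1) (by omega)]
    · rcases lt_or_ge i r with hi | hi
      · have := h1 i (Finset.mem_range.2 hi)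
        omega
      · rw [hKge i hi, hKge (i + 1) (by omega), hmge i hi, hmge (i + 1) (by omega)]
  have hstep := tendsto_finsetProd (Finset.range r) fun i hi =>
    Mallows.tendsto_sqrt_mul_transition hβ hx (Ypos i) (Ylt i (Finset.mem_range.1 hi))
      (hK i) (hm i) (hK (i + 1)) (hm (i + 1))
  have hfinal := hstep.const_mul (√(Mallows.cov β x y).det)
  have hlim : Real.exp (-(α ⬝ᵥ Matrix.mulVec (Mallows.cov β x y)⁻¹ α) / 2) =
      √(Mallows.cov β x y).det * ∏ i ∈ Finset.range r,
        (√(1 / Mallows.innovVar a c i) *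
          Real.exp (-((A i - a i / a (i + 1) * A (i + 1)) ^ 2 / Mallows.innovVar a c i) / 2)) := by
    rw [Finset.prod_mul_distrib, ← Real.exp_sum, ← mul_assoc]
    have h1 : √(Mallows.cov β x y).det *
        ∏ i ∈ Finset.range r, √(1 / Mallows.innovVar a c i) = 1 := by
      rw [hdet, Real.sqrt_prod _ fun i hi => (hv i (Finset.mem_range.1 hi)).le,
        ← Finset.prod_mul_distrib]
      refine Finset.prod_eq_one fun i hi => ?_
      have := hv i (Finset.mem_range.1 hi)
      rw [← Real.sqrt_mul this.le, mul_one_div_cancel this.ne', Real.sqrt_one]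
    rw [h1, one_mul, hquad, ← Finset.sum_div, Finset.sum_neg_distrib]
  rw [hlim]
  refine hfinal.congr' ?_
  filter_upwards [hprob] with N hN
  rw [hN, Finset.prod_mul_distrib, Finset.prod_const, Finset.card_range]
  ring
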